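/- Let $B_1=\{x\in\mathbb{R}^2: |x|<1\}$. There exist a continuous odd function $f:\mathbb{R}\to\mathbb{R}$ with $f(t)\in[-1,0]$ for all $t\ge 0$ (so $f(t)\in[0,1]$ for $t\le 0$) and a function $u$, continuous on $\overline{B_1}$ and belonging to the Besov space $B^2_{\infty,\infty}(B_1)$, such that $$\Delta u=f(u)\quad\text{in } B_1 \text{ in the sense of distributions},\qquad u(x)=x_1x_2\quad\text{for } |x|=1,$$ $u$ is odd in $x_1$ and odd in $x_2$, $u\ge 0$ on $\{x\in \overline{B_1}: x_1\ge 0,\ x_2\ge 0\}$ (so that $f(u)\in[-1,0]$ there), $$u(0)=0,\qquad Du(0)=0,\qquad \sup_{x\in B_1\setminus\{0\}}\frac{u(x)}{|x|^2}=\infty .$$ Moreover $u\in C^1(B_1)$ but $u\notin C^2(B_1)$. In particular, a $C^1$ solution of $\Delta u=f(u)$ with continuous $f$ need not be $C^2$ (a negative answer to a question of Shahgholian). Here $B^2_{\infty,\infty}(B_1)$ is the space of restrictions to $B_1$ of functions in $B^2_{\infty,\infty}(\mathbb{R}^2)$, that is, of bounded continuous $g:\mathbb{R}^2\to\mathbb{R}$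 for which there is a constant $C$ with $|g(x+3h)-3g(x+2h)+3g(x+h)-g(x)|\le C|h|^2$ for all $x,h\in\mathbb{R}^2$. -/

import Mathlib

open Set Metric MeasureTheory
open scoped ContDiff

noncomputable section

/-- The Euclidean plane. -/
abbrev Plane : Type := EuclideanSpace ℝ (Fin 2)

/-- Membership in the Besov space `B^s_{∞,∞}` of the whole space, for real `s > 0`, through the
modulus of smoothness: `g` is bounded and continuous and its forward difference of order
`r = ⌊s⌋ + 1` (the smallest integer larger than `s`) satisfies `|Δ_h^r g (x)| ≤ C |h|^s`
for all `x` and `h`. For `s = 2` these are the third differences. -/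
def MemBesovInfty {E : Type*} [NormedAddCommGroup E] (s : ℝ) (g : E → ℝ) : Prop :=
  Continuous g ∧ (∃ M : ℝ, ∀ x, |g x| ≤ M) ∧
    ∃ C : ℝ, ∀ x h : E, |(fwdDiff h)^[⌊s⌋₊ + 1] g x| ≤ C * ‖h‖ ^ s

/-- Membership in `B^s_{∞,∞}(U)`: restrictions to `U` of elements of `B^s_{∞,∞}` of the
whole space. -/
def MemBesovInftyOn {E : Type*} [NormedAddCommGroup E] (s : ℝ) (u : E → ℝ) (U : Set E) : Prop :=
  ∃ g : E → ℝ, MemBesovInfty s g ∧ EqOn u g U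

/-- `u` satisfies `Δ u = F` in the open set `U` in the sense of distributions: both functions are
locally integrable in `U`, and `∫ u Δφ = ∫ F φ` for all smooth `φ` with compact support in `U`. -/
def IsDistribPoissonSolution (u F : Plane → ℝ) (U : Set Plane) : Prop :=
  LocallyIntegrableOn u U ∧ LocallyIntegrableOn F U ∧
    ∀ φ : Plane → ℝ, ContDiff ℝ ∞ φ → HasCompactSupport φ → tsupport φ ⊆ U →
      ∫ x, u x * Laplacian.laplacian φ x = ∫ x, F x * φ x

end

/-! The nonlinearity is the negative of `nonlin`, where `nonlin t = 1 / (1 - log t)` for small `t >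
0`. It is continuous and nondecreasing but fails the Dini condition at `0`: the integral of `nonlin
s / s` diverges there. In the first quadrant of the disc the solution is superharmonic, so it lies
above the harmonic function `x₀ x₁` with the same boundary values, and `-Δu ≥ nonlin (x₀ x₁)`. At `x
= (t, t)` the Green function of the quarter disc is at least of order `t² / |y|²` for `y` near the
diagonal, `|y| ≥ |x|` and `|y|` small. Hence the dyadic scale `|y| ∼ 2⁻ʲ` contributes at least a
multiple of `t² / j`, and the harmonic series gives `u (t, t) / t² → ∞` (`sum_le_neg_logPot`,
`tendsto_div_norm_sq`). Since oddness forces `u` and `Du` to vanish at `0`, where a `C²` function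
would then be quadratically bounded, `u` is not `C²`.

The Dirichlet problem is solved by images. A density on the disc that is odd in each coordinate is
extended by `kelvinExt` to one that is also odd under inversion in the unit circle, with the
Jacobian weight. Its logarithmic potential is odd under inversion, hence zero on the circle
(`logPot_eq_zero`), so the Green operator is a potential on the whole plane and no boundary
regularity theory is needed. Antisymmetrising the kernel over the group of order eight generated by
the reflections and the inversion turns it into half the logarithm of a quotient `X / Y` of
polynomials whose difference factors (`ae_oddKernel_eq`). This one identity yields both the
comparison principle and the lower bound for the Green function. As `nonlin` is monotone and
bounded, iteration from `x₀ x₁` increases in modulus to a fixed point (`exists_poissonStep_fixed`).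

Regularity uses only boundedness and decay of the density. Regularised kernels have uniformly
convergent gradients, which gives `C¹`. The third difference of `log |z|` with step `h` has `L¹`
norm of order `|h|²`, by scaling and cubic decay, which gives the Besov bound. -/

open Filter Topology

/-! ### Radial integrability -/

/-- The singular part of the gradient of the logarithm. -/
noncomputable def singPart (z : Plane) : ℝ := (ball (0 : Plane) 1).indicator (fun z => ‖z‖⁻¹) z

lemma singPart_nonneg (z : Plane) : 0 ≤ singPart z :=
  indicator_nonneg (fun z _ => inv_nonneg.2 (norm_nonneg z)) z

lemma finrank_plane : Module.finrank ℝ Plane = 2 := by simp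

/-- In polar coordinates the planar Jacobian `r` cancels the singularity `r⁻¹` and leaves the
constant `1` on `(0, 1)`. -/
lemma integrable_singPart : Integrable singPart := by
  have h : singPart = fun z : Plane => (Iio (1 : ℝ)).indicator (fun r : ℝ => r⁻¹) ‖z‖ := by
    ext z
    by_cases hz : ‖z‖ < 1 <;> simp [singPart, indicator, hz]
  rw [h, integrable_fun_norm_addHaar]
  have h2 : ((Ioo (0 : ℝ) 1).indicator (fun _ => (1 : ℝ))) =ᵐ[volume.restrict (Ioi 0)]
      (fun y : ℝ => y ^ (Module.finrank ℝ Plane - 1) • (Iio (1 : ℝ)).indicator (fun r : ℝ => r⁻¹) y) := by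
    filter_upwards [ae_restrict_mem measurableSet_Ioi] with y hy
    have hy' : 0 < y := hy
    by_cases h1 : y < 1 <;> simp [indicator, h1, hy', hy'.ne']
  refine Integrable.congr ?_ h2
  apply Integrable.mono_measure _ Measure.restrict_le_self
  exact (integrableOn_const (by simp)).integrable_indicator measurableSet_Ioo

lemma norm_inv_le_singPart (z : Plane) : ‖z‖⁻¹ ≤ singPart z + 1 := by
  by_cases hz : ‖z‖ < 1
  · simp [singPart, indicator, hz]
  · simp only [singPart, indicator, mem_ball_zero_iff, hz, if_false, zero_add]
    exact inv_le_one_of_one_le₀ (not_lt.1 hz)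

lemma integrable_singPart_sub (x : Plane) : Integrable (fun y => singPart (x - y)) :=
  integrable_singPart.comp_sub_left x

lemma integral_singPart_sub (x : Plane) : ∫ y, singPart (x - y) = ∫ y, singPart y :=
  integral_sub_left_eq_self singPart volume x

lemma integrable_decay_three : Integrable (fun y : Plane => (1 + ‖y‖) ^ (-3 : ℝ)) :=
  integrable_one_add_norm (by rw [finrank_plane]; norm_num)

/-- The bound is deliberately crude: in this form the logarithm, its regularisations and their
gradients share the majorant `logMajorant`. -/
lemma abs_log_le (t : ℝ) (ht : 0 ≤ t) : |Real.log t| ≤ t⁻¹ + t := by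
  rcases ht.eq_or_lt with rfl | ht
  · simp
  rw [abs_le]
  have h1 := Real.log_le_sub_one_of_pos ht
  have h2 := Real.log_le_sub_one_of_pos (inv_pos.2 ht)
  rw [Real.log_inv] at h2
  have := inv_pos.2 ht
  constructor <;> linarith

/-! ### Decaying densities and their logarithmic potentials -/

/-- Measurable densities decaying like the fourth power of the distance. -/
structure IsDecaying (C : ℝ) (H : Plane → ℝ) : Prop where
  measurable : Measurable H
  bound : ∀ y, |H y| ≤ C * (1 + ‖y‖) ^ (-4 : ℝ)

lemma rpow_neg_le_one (y : Plane) (s : ℝ) (hs : s ≤ 0) : (1 + ‖y‖) ^ s ≤ 1 :=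
  Real.rpow_le_one_of_one_le_of_nonpos (by linarith [norm_nonneg y]) hs

namespace IsDecaying

variable {C : ℝ} {H : Plane → ℝ}

lemma nonneg (hH : IsDecaying C H) : 0 ≤ C := by
  have := (abs_nonneg _).trans (hH.bound 0)
  simpa using this

lemma abs_le (hH : IsDecaying C H) (y : Plane) : |H y| ≤ C :=
  (hH.bound y).trans (mul_le_of_le_one_right hH.nonneg (rpow_neg_le_one y _ (by norm_num)))

/-- One of the four powers of decay pays for the linear growth of the kernel bound at infinity; the
remaining three are still integrable in the plane. -/
lemma mul_abs_le (hH : IsDecaying C H) (y : Plane) :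
    (1 + ‖y‖) * |H y| ≤ C * (1 + ‖y‖) ^ (-3 : ℝ) := by
  have h0 : 0 < 1 + ‖y‖ := by positivity
  calc (1 + ‖y‖) * |H y| ≤ (1 + ‖y‖) * (C * (1 + ‖y‖) ^ (-4 : ℝ)) := by
        gcongr; exact hH.bound y
    _ = C * ((1 + ‖y‖) ^ (1 : ℝ) * (1 + ‖y‖) ^ (-4 : ℝ)) := by rw [Real.rpow_one]; ring
    _ = _ := by rw [← Real.rpow_add h0]; norm_num

end IsDecaying

/-- An integrable majorant for logarithmic kernels times a decaying density. -/
noncomputable def logMajorant (C : ℝ) (x y : Plane) : ℝ :=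
  C * singPart (x - y) + (2 + ‖x‖) * (C * (1 + ‖y‖) ^ (-3 : ℝ))

lemma integrable_logMajorant (C : ℝ) (x : Plane) : Integrable (logMajorant C x) :=
  ((integrable_singPart_sub x).const_mul C).add ((integrable_decay_three.const_mul C).const_mul _)

lemma integral_logMajorant (C : ℝ) (x : Plane) : ∫ y, logMajorant C x y =
    C * (∫ y, singPart y) + (2 + ‖x‖) * (C * ∫ y : Plane, (1 + ‖y‖) ^ (-3 : ℝ)) := by
  unfold logMajorant
  rw [integral_add ((integrable_singPart_sub x).const_mul C)
    ((integrable_decay_three.const_mul C).const_mul _)]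
  simp only [integral_const_mul, integral_singPart_sub]

lemma IsDecaying.mul_le_logMajorant {C : ℝ} {H : Plane → ℝ} (hH : IsDecaying C H) (x y : Plane)
    {k : ℝ} (hk : |k| ≤ ‖x - y‖⁻¹ + ‖x - y‖) : ‖k * H y‖ ≤ logMajorant C x y := by
  rw [Real.norm_eq_abs, abs_mul]
  have h1 := norm_inv_le_singPart (x - y)
  have h2 := norm_sub_le x y
  have h3 := singPart_nonneg (x - y)
  have hx := norm_nonneg x
  have hy := norm_nonneg y
  have hk' : |k| ≤ singPart (x - y) + (2 + ‖x‖) * (1 + ‖y‖) := by nlinarith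
  calc |k| * |H y| ≤ (singPart (x - y) + (2 + ‖x‖) * (1 + ‖y‖)) * |H y| := by gcongr
    _ = singPart (x - y) * |H y| + (2 + ‖x‖) * ((1 + ‖y‖) * |H y|) := by ring
    _ ≤ singPart (x - y) * C + (2 + ‖x‖) * (C * (1 + ‖y‖) ^ (-3 : ℝ)) := by
        exact add_le_add (mul_le_mul_of_nonneg_left (hH.abs_le y) h3)
          (mul_le_mul_of_nonneg_left (hH.mul_abs_le y) (by positivity))
    _ = _ := by unfold logMajorant; ring

/-- The logarithmic potential, without normalisation. -/
noncomputable def logPot (H : Plane → ℝ) (x : Plane) : ℝ := ∫ y, Real.log ‖x - y‖ * H y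

lemma IsDecaying.log_mul_le {C : ℝ} {H : Plane → ℝ} (hH : IsDecaying C H) (x y : Plane) :
    ‖Real.log ‖x - y‖ * H y‖ ≤ logMajorant C x y :=
  hH.mul_le_logMajorant x y (abs_log_le _ (norm_nonneg _))

lemma IsDecaying.integrable_log_mul {C : ℝ} {H : Plane → ℝ} (hH : IsDecaying C H) (x : Plane) :
    Integrable (fun y => Real.log ‖x - y‖ * H y) := by
  refine (integrable_logMajorant C x).mono' ?_ (.of_forall fun y => hH.log_mul_le x y)
  exact ((Real.measurable_log.comp (by fun_prop)).mul hH.measurable).aestronglyMeasurable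

lemma IsDecaying.integrable {C : ℝ} {H : Plane → ℝ} (hH : IsDecaying C H) : Integrable H := by
  refine (integrable_decay_three.const_mul C).mono' hH.measurable.aestronglyMeasurable
    (.of_forall fun y => ?_)
  refine le_trans ?_ (hH.mul_abs_le y)
  rw [Real.norm_eq_abs]
  nlinarith [norm_nonneg y, abs_nonneg (H y)]

lemma IsDecaying.abs_logPot_le {C : ℝ} {H : Plane → ℝ} (hH : IsDecaying C H) (x : Plane) :
    |logPot H x| ≤
      C * (∫ y, singPart y) + (2 + ‖x‖) * (C * ∫ y : Plane, (1 + ‖y‖) ^ (-3 : ℝ)) := by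
  rw [← integral_logMajorant]
  exact norm_integral_le_of_norm_le (integrable_logMajorant C x)
    (.of_forall fun y => hH.log_mul_le x y)

/-! ### Regularised kernels -/

/-- The smooth approximation `½ log (|z|² + a)` of `log |z|`. -/
noncomputable def regLog (a : ℝ) (z : Plane) : ℝ := Real.log (‖z‖ ^ 2 + a) / 2

/-- The gradient of `regLog a`. -/
noncomputable def gradLog (a : ℝ) (z : Plane) : Plane →L[ℝ] ℝ := (‖z‖ ^ 2 + a)⁻¹ • innerSL ℝ z

lemma abs_regLog_le {a : ℝ} (ha : 0 ≤ a) (ha1 : a ≤ 1) {z : Plane} (hz : z ≠ 0) :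
    |regLog a z| ≤ ‖z‖⁻¹ + ‖z‖ := by
  have hz' := norm_pos_iff.2 hz
  have h1 : Real.log (‖z‖ ^ 2) ≤ Real.log (‖z‖ ^ 2 + a) :=
    Real.log_le_log (by positivity) (by linarith)
  have h2 : Real.log (‖z‖ ^ 2 + a) ≤ Real.log ((1 + ‖z‖) ^ 2) :=
    Real.log_le_log (by positivity) (by nlinarith)
  have h3 := Real.log_le_sub_one_of_pos (show 0 < 1 + ‖z‖ by positivity)
  have h4 := Real.log_le_sub_one_of_pos (inv_pos.2 hz')
  rw [Real.log_inv] at h4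
  rw [Real.log_pow] at h1 h2
  push_cast at h1 h2
  have := inv_pos.2 hz'
  unfold regLog
  rw [abs_le]
  constructor <;> linarith

lemma norm_gradLog_le {a : ℝ} (ha : 0 ≤ a) (z : Plane) : ‖gradLog a z‖ ≤ ‖z‖⁻¹ := by
  rcases eq_or_ne z 0 with rfl | hz
  · simp [gradLog]
  have hz' := norm_pos_iff.2 hz
  rw [gradLog, norm_smul, innerSL_apply_norm, Real.norm_of_nonneg (by positivity)]
  rw [inv_mul_eq_div, div_le_iff₀ (by positivity)]
  field_simp
  linarith

lemma norm_gradLog_le_of_pos {a : ℝ} (ha : 0 < a) (z : Plane) : ‖gradLog a z‖ ≤ a⁻¹ + 1 := by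
  rw [gradLog, norm_smul, innerSL_apply_norm, Real.norm_of_nonneg (by positivity)]
  rw [inv_mul_eq_div, div_le_iff₀ (by positivity)]
  have : (a⁻¹ + 1) * (‖z‖ ^ 2 + a) = a⁻¹ * ‖z‖ ^ 2 + 1 + ‖z‖ ^ 2 + a := by field_simp; ring
  rw [this]
  have : 0 ≤ a⁻¹ * ‖z‖ ^ 2 := by positivity
  nlinarith [sq_nonneg (‖z‖ - 1)]

lemma contDiff_regLog {a : ℝ} (ha : 0 < a) {n : ℕ∞} : ContDiff ℝ n (regLog a) := by
  unfold regLog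
  exact (((contDiff_norm_sq ℝ).add contDiff_const).log fun z => by positivity).div_const _

lemma hasFDerivAt_regLog {a : ℝ} (ha : 0 < a) (z : Plane) :
    HasFDerivAt (regLog a) (gradLog a z) z := by
  have h := (((hasStrictFDerivAt_norm_sq z).hasFDerivAt.add_const a).log
    (by positivity)).mul_const (1 / 2 : ℝ)
  refine (h.congr_fderiv ?_).congr_of_eventuallyEq (.of_forall fun y => ?_)
  · ext v
    simp [gradLog]
    ring
  · simp [regLog, div_eq_mul_inv]

lemma continuous_gradLog {a : ℝ} (ha : 0 < a) : Continuous (gradLog a) := by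
  unfold gradLog
  have h : Continuous fun z : Plane => (‖z‖ ^ 2 + a)⁻¹ :=
    Continuous.inv₀ (by fun_prop) fun z => by positivity
  exact h.smul (innerSL ℝ (E := Plane)).continuous

lemma measurable_gradLog (a : ℝ) : Measurable (gradLog a) := by
  unfold gradLog
  have h : Measurable fun z : Plane => (‖z‖ ^ 2 + a)⁻¹ := by fun_prop
  exact h.smul (innerSL ℝ (E := Plane)).continuous.measurable

/-- The norm of the difference of the regularised and the singular gradient. -/
noncomputable def gradGap (a : ℝ) (z : Plane) : ℝ := a / ((‖z‖ ^ 2 + a) * ‖z‖)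

lemma norm_gradLog_sub {a : ℝ} (ha : 0 < a) {z : Plane} (hz : z ≠ 0) :
    ‖gradLog a z - gradLog 0 z‖ = gradGap a z := by
  have hz' := norm_pos_iff.2 hz
  have : gradLog a z - gradLog 0 z = (-(a / ((‖z‖ ^ 2 + a) * ‖z‖ ^ 2))) • innerSL ℝ z := by
    ext v
    simp only [gradLog, sub_apply, smul_apply, smul_eq_mul]
    field_simp
    ring
  rw [this, norm_smul, innerSL_apply_norm, norm_neg, Real.norm_of_nonneg (by positivity), gradGap]
  field_simp

/-- The gap increases with `a`, so its value at `a = 1` dominates. That value is at most `‖z‖⁻¹` in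
the unit disc and `‖z‖⁻³` outside, where `1 + ‖z‖ ≤ 2 ‖z‖` accounts for the factor `8 = 2³`. -/
lemma gradGap_le {a : ℝ} (ha : 0 < a) (ha1 : a ≤ 1) (z : Plane) :
    ‖gradGap a z‖ ≤ singPart z + 8 * (1 + ‖z‖) ^ (-3 : ℝ) := by
  have hz0 := norm_nonneg z
  have h1 : gradGap a z ≤ 1 / ((‖z‖ ^ 2 + 1) * ‖z‖) := by
    rcases eq_or_ne z 0 with rfl | hz
    · simp [gradGap]
    have hz' := norm_pos_iff.2 hz
    rw [gradGap, div_le_div_iff₀ (by positivity) (by positivity)]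
    nlinarith [mul_nonneg (sub_nonneg.2 ha1) (pow_nonneg hz0 3)]
  rw [Real.norm_of_nonneg (by unfold gradGap; positivity)]
  refine h1.trans ?_
  have h3 : (1 + ‖z‖) ^ (-3 : ℝ) = ((1 + ‖z‖) ^ 3)⁻¹ := by
    rw [Real.rpow_neg (by positivity)]; norm_cast
  rw [h3]
  by_cases hz : ‖z‖ < 1
  · have : singPart z = ‖z‖⁻¹ := by simp [singPart, indicator, hz]
    rw [this]
    have : 1 / ((‖z‖ ^ 2 + 1) * ‖z‖) ≤ ‖z‖⁻¹ := by
      rw [one_div, mul_inv]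
      exact mul_le_of_le_one_left (by positivity) (inv_le_one_of_one_le₀ (by nlinarith))
    have : 0 ≤ 8 * ((1 + ‖z‖) ^ 3)⁻¹ := by positivity
    linarith
  · push Not at hz
    have : 1 / ((‖z‖ ^ 2 + 1) * ‖z‖) ≤ 8 * ((1 + ‖z‖) ^ 3)⁻¹ := by
      rw [← div_eq_mul_inv, div_le_div_iff₀ (by positivity) (by positivity)]
      have : (1 + ‖z‖) ^ 3 ≤ (2 * ‖z‖) ^ 3 := by gcongr; linarith
      nlinarith
    linarith [singPart_nonneg z]

lemma integrable_gradGap_majorant :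
    Integrable (fun z : Plane => singPart z + 8 * (1 + ‖z‖) ^ (-3 : ℝ)) :=
  integrable_singPart.add (integrable_decay_three.const_mul _)

lemma integrable_gradGap {a : ℝ} (ha : 0 < a) (ha1 : a ≤ 1) : Integrable (gradGap a) :=
  integrable_gradGap_majorant.mono' 
    (Measurable.aestronglyMeasurable (by unfold gradGap; fun_prop))
    (.of_forall fun z => gradGap_le ha ha1 z)

/-- A sequence of regularisation parameters. -/
noncomputable def regSeq (n : ℕ) : ℝ := 1 / ((n : ℝ) + 1)

lemma regSeq_pos (n : ℕ) : 0 < regSeq n := by unfold regSeq; positivity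

lemma regSeq_le_one (n : ℕ) : regSeq n ≤ 1 := by
  unfold regSeq
  rw [div_le_one (by positivity)]
  linarith [(Nat.cast_nonneg n : (0 : ℝ) ≤ n)]

lemma tendsto_regSeq : Tendsto regSeq atTop (𝓝 0) := tendsto_one_div_add_atTop_nhds_zero_nat

lemma ae_ne_plane (p : Plane) : ∀ᵐ z : Plane, z ≠ p := by
  simp [ae_iff]

lemma tendsto_integral_gradGap :
    Tendsto (fun n => ∫ z, gradGap (regSeq n) z) atTop (𝓝 0) := by
  have : Tendsto (fun n => ∫ z, gradGap (regSeq n) z) atTop (𝓝 (∫ _ : Plane, (0 : ℝ))) := by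
    refine tendsto_integral_of_dominated_convergence _
      (fun n => (integrable_gradGap (regSeq_pos n) (regSeq_le_one n)).aestronglyMeasurable)
      integrable_gradGap_majorant
      (fun n => .of_forall fun z => gradGap_le (regSeq_pos n) (regSeq_le_one n) z) ?_
    filter_upwards [ae_ne_plane 0] with z hz
    have hz' := norm_pos_iff.2 hz
    have : Tendsto (fun a : ℝ => a / ((‖z‖ ^ 2 + a) * ‖z‖)) (𝓝 0)
        (𝓝 (0 / ((‖z‖ ^ 2 + 0) * ‖z‖))) := by
      apply ContinuousAt.tendsto
      exact ContinuousAt.div (by fun_prop) (by fun_prop) (by positivity)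
    rw [zero_div] at this
    exact this.comp tendsto_regSeq
  simpa using this

/-! ### Differentiability of the logarithmic potential -/

lemma hasFDerivAt_comp_sub_const {f : Plane → ℝ} {f' : Plane →L[ℝ] ℝ} {x y : Plane}
    (h : HasFDerivAt f f' (x - y)) : HasFDerivAt (fun z => f (z - y)) f' x := by
  exact (hasFDerivAt_comp_sub y).2 h

/-- The regularised logarithmic potential. -/
noncomputable def regPot (a : ℝ) (H : Plane → ℝ) (x : Plane) : ℝ := ∫ y, regLog a (x - y) * H y

/-- The gradient of the (regularised) logarithmic potential. -/
noncomputable def gradPot (a : ℝ) (H : Plane → ℝ) (x : Plane) : Plane →L[ℝ] ℝ :=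
  ∫ y, H y • gradLog a (x - y)

lemma measurable_regLog (a : ℝ) : Measurable (regLog a) := by
  unfold regLog; fun_prop

namespace IsDecaying

variable {C : ℝ} {H : Plane → ℝ}

lemma ae_regLog_mul_le (hH : IsDecaying C H) {a : ℝ} (ha : 0 ≤ a) (ha1 : a ≤ 1) (x : Plane) :
    ∀ᵐ y, ‖regLog a (x - y) * H y‖ ≤ logMajorant C x y := by
  filter_upwards [ae_ne_plane x] with y hy
  exact hH.mul_le_logMajorant x y (abs_regLog_le ha ha1 (sub_ne_zero.2 hy.symm))

lemma aestronglyMeasurable_regLog_mul (hH : IsDecaying C H) (a : ℝ) (x : Plane) :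
    AEStronglyMeasurable (fun y => regLog a (x - y) * H y) :=
  (((measurable_regLog a).comp (by fun_prop)).mul hH.measurable).aestronglyMeasurable

lemma aestronglyMeasurable_gradLog_smul (hH : IsDecaying C H) (a : ℝ) (x : Plane) :
    AEStronglyMeasurable (fun y => H y • gradLog a (x - y)) :=
  (hH.measurable.smul ((measurable_gradLog a).comp (by fun_prop))).aestronglyMeasurable

lemma integrable_regLog_mul (hH : IsDecaying C H) {a : ℝ} (ha : 0 ≤ a) (ha1 : a ≤ 1) (x : Plane) :
    Integrable (fun y => regLog a (x - y) * H y) :=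
  (integrable_logMajorant C x).mono' (hH.aestronglyMeasurable_regLog_mul a x)
    (hH.ae_regLog_mul_le ha ha1 x)

lemma integrable_gradLog_smul (hH : IsDecaying C H) {a : ℝ} (ha : 0 ≤ a) (x : Plane) :
    Integrable (fun y => H y • gradLog a (x - y)) := by
  refine (integrable_logMajorant C x).mono' (hH.aestronglyMeasurable_gradLog_smul a x)
    (.of_forall fun y => ?_)
  rw [norm_smul, mul_comm]
  have h := hH.mul_le_logMajorant x y (k := ‖gradLog a (x - y)‖)
    (by rw [abs_norm]; linarith [norm_gradLog_le ha (x - y), norm_nonneg (x - y)])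
  rwa [norm_mul, norm_norm] at h

lemma tendsto_regPot (hH : IsDecaying C H) (x : Plane) :
    Tendsto (fun n => regPot (regSeq n) H x) atTop (𝓝 (logPot H x)) := by
  refine tendsto_integral_of_dominated_convergence _
    (fun n => hH.aestronglyMeasurable_regLog_mul _ x) (integrable_logMajorant C x)
    (fun n => hH.ae_regLog_mul_le (regSeq_pos n).le (regSeq_le_one n) x) ?_
  filter_upwards [ae_ne_plane x] with y hy
  have hz : 0 < ‖x - y‖ := norm_pos_iff.2 (sub_ne_zero.2 hy.symm)
  have h : Tendsto (fun a : ℝ => Real.log (‖x - y‖ ^ 2 + a) / 2 * H y) (𝓝 0)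
      (𝓝 (Real.log (‖x - y‖ ^ 2 + 0) / 2 * H y)) := by
    apply ContinuousAt.tendsto
    have : ‖x - y‖ ^ 2 + 0 ≠ 0 := by positivity
    fun_prop (disch := assumption)
  rw [add_zero, Real.log_pow] at h
  push_cast at h
  rw [mul_div_cancel_left₀ _ two_ne_zero] at h
  exact h.comp tendsto_regSeq

/-- For fixed `a > 0` the kernel gradient is bounded, so the majorant of the derivative does not
depend on `x` and differentiation under the integral is immediate. -/
lemma hasFDerivAt_regPot (hH : IsDecaying C H) {a : ℝ} (ha : 0 < a) (ha1 : a ≤ 1) (x : Plane) :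
    HasFDerivAt (regPot a H) (gradPot a H x) x := by
  refine hasFDerivAt_integral_of_dominated_of_fderiv_le (s := univ) univ_mem
    (F := fun x y => regLog a (x - y) * H y) (F' := fun x y => H y • gradLog a (x - y))
    (bound := fun y => (a⁻¹ + 1) * |H y|)
    (.of_forall fun x => hH.aestronglyMeasurable_regLog_mul a x)
    (hH.integrable_regLog_mul ha.le ha1 x) (hH.aestronglyMeasurable_gradLog_smul a x)
    (.of_forall fun y x _ => ?_) (hH.integrable.abs.const_mul _) (.of_forall fun y x _ => ?_)
  · rw [norm_smul, mul_comm, Real.norm_eq_abs]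
    gcongr
    exact norm_gradLog_le_of_pos ha _
  · exact (hasFDerivAt_comp_sub_const (hasFDerivAt_regLog ha (x - y))).mul_const (H y)

lemma continuous_gradPot (hH : IsDecaying C H) {a : ℝ} (ha : 0 < a) :
    Continuous (gradPot a H) := by
  refine continuous_of_dominated (bound := fun y => (a⁻¹ + 1) * |H y|)
    (fun x => hH.aestronglyMeasurable_gradLog_smul a x) (fun x => .of_forall fun y => ?_)
    (hH.integrable.abs.const_mul _) (.of_forall fun y => ?_)
  · rw [norm_smul, mul_comm, Real.norm_eq_abs]
    gcongr
    exact norm_gradLog_le_of_pos ha _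
  · exact ((continuous_gradLog ha).comp (by fun_prop)).const_smul (H y)

/-- Bounding the density by `C` leaves the `L¹` norm of a translate of `gradGap a`, which is
independent of `x`; this is what makes the convergence of gradients uniform. -/
lemma norm_gradPot_sub_le (hH : IsDecaying C H) {a : ℝ} (ha : 0 < a) (ha1 : a ≤ 1) (x : Plane) :
    ‖gradPot 0 H x - gradPot a H x‖ ≤ C * ∫ z, gradGap a z := by
  unfold gradPot
  rw [← integral_sub (hH.integrable_gradLog_smul le_rfl x) (hH.integrable_gradLog_smul ha.le x),
    ← integral_sub_left_eq_self (gradGap a) volume x, ← integral_const_mul]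
  refine norm_integral_le_of_norm_le (((integrable_gradGap ha ha1).comp_sub_left x).const_mul C) ?_
  filter_upwards [ae_ne_plane x] with y hy
  have hg := norm_gradLog_sub ha (sub_ne_zero.2 hy.symm)
  have he : H y • gradLog 0 (x - y) - H y • gradLog a (x - y) =
      H y • (gradLog 0 (x - y) - gradLog a (x - y)) := (smul_sub _ _ _).symm
  rw [he, norm_smul, norm_sub_rev, hg]
  exact mul_le_mul_of_nonneg_right (hH.abs_le y) (hg ▸ norm_nonneg _)

lemma tendstoUniformly_gradPot (hH : IsDecaying C H) :
    TendstoUniformly (fun n => gradPot (regSeq n) H) (gradPot 0 H) atTop := by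
  rw [Metric.tendstoUniformly_iff]
  intro ε hε
  have h := tendsto_integral_gradGap.const_mul C
  rw [mul_zero] at h
  filter_upwards [h.eventually_lt_const hε] with n hn x
  rw [dist_eq_norm]
  exact (hH.norm_gradPot_sub_le (regSeq_pos n) (regSeq_le_one n) x).trans_lt hn

lemma hasFDerivAt_logPot (hH : IsDecaying C H) (x : Plane) :
    HasFDerivAt (logPot H) (gradPot 0 H x) x :=
  hasFDerivAt_of_tendstoUniformly hH.tendstoUniformly_gradPot
    (fun n x => hH.hasFDerivAt_regPot (regSeq_pos n) (regSeq_le_one n) x)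
    hH.tendsto_regPot x

lemma contDiff_logPot (hH : IsDecaying C H) : ContDiff ℝ 1 (logPot H) := by
  rw [contDiff_one_iff_fderiv]
  refine ⟨fun x => (hH.hasFDerivAt_logPot x).differentiableAt, ?_⟩
  rw [show fderiv ℝ (logPot H) = gradPot 0 H from funext fun x => (hH.hasFDerivAt_logPot x).fderiv]
  exact hH.tendstoUniformly_gradPot.continuous
    (Eventually.frequently (.of_forall fun n => hH.continuous_gradPot (regSeq_pos n)))

end IsDecaying

/-! ### The weak Laplacian of the logarithmic potential -/

/-- The coordinate vectors. -/
noncomputable def coordVec (i : Fin 2) : Plane := EuclideanSpace.single i 1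

lemma laplacian_eq_sum_fderiv {φ : Plane → ℝ} (hφ : ContDiff ℝ 2 φ) (x : Plane) :
    Laplacian.laplacian φ x =
      ∑ i, fderiv ℝ (fun y => fderiv ℝ φ y (coordVec i)) x (coordVec i) := by
  rw [InnerProductSpace.laplacian_eq_iteratedFDeriv_orthonormalBasis φ
    (EuclideanSpace.basisFun (Fin 2) ℝ)]
  refine Finset.sum_congr rfl fun i _ => ?_
  have hd : DifferentiableAt ℝ (fderiv ℝ φ) x :=
    ((hφ.fderiv_right (m := 1) (by norm_num)).differentiable (by norm_num)).differentiableAt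
  rw [iteratedFDeriv_two_apply, fderiv_clm_apply hd (by fun_prop)]
  simp [coordVec]

lemma integral_mul_fderiv_coord {F G : Plane → ℝ} (hF : ContDiff ℝ 1 F) (hG : ContDiff ℝ 1 G)
    (hs : HasCompactSupport F ∨ HasCompactSupport G) (v : Plane) :
    ∫ x, F x * fderiv ℝ G x v = -∫ x, fderiv ℝ F x v * G x := by
  have cF : Continuous fun x => fderiv ℝ F x v := (hF.continuous_fderiv (by norm_num)).clm_apply continuous_const
  have cG : Continuous fun x => fderiv ℝ G x v := (hG.continuous_fderiv (by norm_num)).clm_apply continuous_const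
  refine integral_mul_fderiv_eq_neg_fderiv_mul_of_integrable ?_ ?_ ?_
    (fun x _ => (hF.differentiable (by norm_num)) x) (fun x _ => (hG.differentiable (by norm_num)) x)
  · refine (cF.mul hG.continuous).integrable_of_hasCompactSupport ?_
    rcases hs with hs | hs
    · exact (hs.fderiv_apply (𝕜 := ℝ) v).mul_right
    · exact hs.mul_left
  · refine (hF.continuous.mul cG).integrable_of_hasCompactSupport ?_
    rcases hs with hs | hs
    · exact hs.mul_right
    · exact (hs.fderiv_apply (𝕜 := ℝ) v).mul_left
  · refine (hF.continuous.mul hG.continuous).integrable_of_hasCompactSupport ?_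
    rcases hs with hs | hs
    · exact hs.mul_right
    · exact hs.mul_left

lemma contDiff_fderiv_coord {φ : Plane → ℝ} (hφ : ContDiff ℝ 2 φ) (v : Plane) :
    ContDiff ℝ 1 (fun y => fderiv ℝ φ y v) :=
  (hφ.fderiv_right (m := 1) (by norm_num)).clm_apply contDiff_const

lemma continuous_laplacian {φ : Plane → ℝ} (hφ : ContDiff ℝ 2 φ) :
    Continuous (Laplacian.laplacian φ) := by
  rw [funext fun x => laplacian_eq_sum_fderiv hφ x]
  exact continuous_finsetSum _ fun i _ =>
    ((contDiff_fderiv_coord hφ _).continuous_fderiv (by norm_num)).clm_apply continuous_const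

lemma hasCompactSupport_laplacian {φ : Plane → ℝ} (hφ : ContDiff ℝ 2 φ)
    (hs : HasCompactSupport φ) : HasCompactSupport (Laplacian.laplacian φ) := by
  rw [funext fun x => laplacian_eq_sum_fderiv hφ x]
  simp only [Fin.sum_univ_two]
  exact ((hs.fderiv_apply (𝕜 := ℝ) _).fderiv_apply (𝕜 := ℝ) _).add
    ((hs.fderiv_apply (𝕜 := ℝ) _).fderiv_apply (𝕜 := ℝ) _)

/-- Green's identity for a compactly supported test function. -/
lemma integral_mul_laplacian {F φ : Plane → ℝ} (hF : ContDiff ℝ 2 F) (hφ : ContDiff ℝ 2 φ)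
    (hs : HasCompactSupport φ) :
    ∫ x, F x * Laplacian.laplacian φ x = ∫ x, Laplacian.laplacian F x * φ x := by
  have hF1 := hF.of_le (m := 1) (by norm_num)
  have hφ1 := hφ.of_le (m := 1) (by norm_num)
  have key : ∀ i, ∫ x, F x * fderiv ℝ (fun y => fderiv ℝ φ y (coordVec i)) x (coordVec i) =
      ∫ x, fderiv ℝ (fun y => fderiv ℝ F y (coordVec i)) x (coordVec i) * φ x := fun i => by
    rw [integral_mul_fderiv_coord hF1 (contDiff_fderiv_coord hφ _)
      (.inr (hs.fderiv_apply (𝕜 := ℝ) _)),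
      integral_mul_fderiv_coord (contDiff_fderiv_coord hF _) hφ1 (.inr hs), neg_neg]
  simp only [laplacian_eq_sum_fderiv hF, laplacian_eq_sum_fderiv hφ, Finset.mul_sum,
    Finset.sum_mul]
  rw [integral_finsetSum, integral_finsetSum]
  · exact Finset.sum_congr rfl fun i _ => key i
  · intro i _
    exact ((((contDiff_fderiv_coord hF _).continuous_fderiv (by norm_num)).clm_apply
      continuous_const).mul hφ.continuous).integrable_of_hasCompactSupport hs.mul_left
  · intro i _
    exact (hF.continuous.mul (((contDiff_fderiv_coord hφ _).continuous_fderiv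
      (by norm_num)).clm_apply continuous_const)).integrable_of_hasCompactSupport
      (((hs.fderiv_apply (𝕜 := ℝ) _).fderiv_apply (𝕜 := ℝ) _).mul_left)

/-! ### The regularised Laplacian as an approximate identity -/

/-- The Laplacian of `regLog a`. -/
noncomputable def regDelta (a : ℝ) (z : Plane) : ℝ := 2 * a / (‖z‖ ^ 2 + a) ^ 2

lemma norm_sq_plane (z : Plane) : ‖z‖ ^ 2 = z 0 ^ 2 + z 1 ^ 2 := by
  rw [EuclideanSpace.real_norm_sq_eq, Fin.sum_univ_two]

lemma inner_coordVec (z : Plane) (i : Fin 2) : inner ℝ z (coordVec i) = z i := by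
  simp [coordVec, EuclideanSpace.inner_single_right]

/-- With `ρ = ‖x - y‖² + a` the two second derivatives add up to `2 / ρ - 2 ‖x - y‖² / ρ²`; in
dimension two only `2 a / ρ²` survives. -/
lemma laplacian_regLog_sub {a : ℝ} (ha : 0 < a) (y x : Plane) :
    Laplacian.laplacian (fun x => regLog a (x - y)) x = regDelta a (x - y) := by
  have hC : ContDiff ℝ 2 (fun x => regLog a (x - y)) :=
    (contDiff_regLog ha (n := 2)).comp (by fun_prop)
  rw [laplacian_eq_sum_fderiv hC]
  have h1 : ∀ i z, fderiv ℝ (fun x => regLog a (x - y)) z (coordVec i) =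
      (‖z - y‖ ^ 2 + a)⁻¹ * (z - y) i := fun i z => by
    rw [(hasFDerivAt_comp_sub_const (hasFDerivAt_regLog ha (z - y))).fderiv]
    simp [gradLog, ← inner_coordVec, inner_sub_left]
  have h2 : ∀ i, fderiv ℝ (fun z => fderiv ℝ (fun x => regLog a (x - y)) z (coordVec i)) x
      (coordVec i) = (‖x - y‖ ^ 2 + a)⁻¹ - 2 * (x - y) i ^ 2 / (‖x - y‖ ^ 2 + a) ^ 2 := fun i => by
    simp only [h1]
    have hne : ‖x - y‖ ^ 2 + a ≠ 0 := by positivity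
    have hA : HasFDerivAt (fun z : Plane => ‖z - y‖ ^ 2 + a) (2 • innerSL ℝ (x - y)) x :=
      (hasFDerivAt_comp_sub_const (hasStrictFDerivAt_norm_sq (x - y)).hasFDerivAt).add_const a
    have hB : HasFDerivAt (fun z : Plane => (z - y) i)
        (EuclideanSpace.proj i : Plane →L[ℝ] ℝ) x :=
      hasFDerivAt_comp_sub_const (f := fun z : Plane => z i)
        ((EuclideanSpace.proj i : Plane →L[ℝ] ℝ).hasFDerivAt)
    have hI := (hasDerivAt_inv hne).comp_hasFDerivAt x hA
    have hM : HasFDerivAt (fun z : Plane => (‖z - y‖ ^ 2 + a)⁻¹ * (z - y) i) _ x := hI.mul hB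
    rw [hM.fderiv]
    have h4 : (EuclideanSpace.proj i : Plane →L[ℝ] ℝ) (coordVec i) = 1 := by simp [coordVec]
    have h3 := inner_coordVec (x - y) i
    simp only [add_apply, smul_apply, innerSL_apply_apply, h3, smul_eq_mul, Function.comp_apply,
      h4, nsmul_eq_mul]
    field_simp
    push_cast
    ring
  simp only [h2, Fin.sum_univ_two, regDelta]
  have hne : ‖x - y‖ ^ 2 + a ≠ 0 := by positivity
  have := norm_sq_plane (x - y)
  field_simp
  linarith

lemma regDelta_nonneg {a : ℝ} (ha : 0 ≤ a) (z : Plane) : 0 ≤ regDelta a z := by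
  unfold regDelta; positivity

lemma integrable_regDelta_one : Integrable (regDelta 1) := by
  refine (integrable_decay_three.const_mul 8).mono'
    (Measurable.aestronglyMeasurable (by unfold regDelta; fun_prop)) (.of_forall fun z => ?_)
  have hz := norm_nonneg z
  have h3 : (1 + ‖z‖) ^ (-3 : ℝ) = ((1 + ‖z‖) ^ 3)⁻¹ := by
    rw [Real.rpow_neg (by positivity)]; norm_cast
  rw [Real.norm_of_nonneg (regDelta_nonneg zero_le_one z), h3, regDelta, ← div_eq_mul_inv,
    div_le_div_iff₀ (by positivity) (by positivity)]
  nlinarith [sq_nonneg (‖z‖ - 1), mul_nonneg hz (sq_nonneg (‖z‖ - 1)),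
    mul_nonneg hz (sq_nonneg (‖z‖ ^ 2 - 1)), sq_nonneg (‖z‖ ^ 2 - 1), pow_nonneg hz 3,
    sq_nonneg (‖z‖ ^ 2 - ‖z‖)]

/-- The mass of the approximate identity `regDelta a`. -/
noncomputable def logMass : ℝ := ∫ z, regDelta 1 z

/-- Positivity is all that is needed for normalisation; the value `2π` is never computed. -/
lemma logMass_pos : 0 < logMass := by
  refine (integral_pos_iff_support_of_nonneg (regDelta_nonneg zero_le_one)
    integrable_regDelta_one).2 ?_
  have : Function.support (regDelta 1) = univ := by
    ext z
    simp only [regDelta, Function.mem_support, mem_univ, iff_true]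
    positivity
  rw [this]
  simp

/-- `regDelta (s²)` is the dilation of `regDelta 1` to scale `s` that preserves mass in the plane.
-/
lemma integral_regDelta_sub_mul {s : ℝ} (hs : 0 < s) (φ : Plane → ℝ) (y : Plane) :
    ∫ x, regDelta (s ^ 2) (x - y) * φ x = ∫ z, regDelta 1 z * φ (s • z + y) := by
  have h1 : ∫ x, regDelta (s ^ 2) (x - y) * φ x = ∫ x, regDelta (s ^ 2) x * φ (x + y) := by
    rw [← integral_add_right_eq_self _ y]
    simp
  have h2 := Measure.integral_comp_smul (volume : Measure Plane)
    (fun x => regDelta (s ^ 2) x * φ (x + y)) s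
  rw [finrank_plane, abs_of_pos (by positivity), smul_eq_mul] at h2
  rw [h1]
  have h3 : ∫ x, regDelta (s ^ 2) x * φ (x + y) =
      s ^ 2 * ∫ x, regDelta (s ^ 2) (s • x) * φ (s • x + y) := by
    rw [h2]; field_simp
  rw [h3, ← integral_const_mul]
  congr 1 with z
  simp only [regDelta, norm_smul, Real.norm_of_nonneg hs.le]
  have : ‖z‖ ^ 2 + 1 ≠ 0 := by positivity
  have : (s * ‖z‖) ^ 2 + s ^ 2 = s ^ 2 * (‖z‖ ^ 2 + 1) := by ring
  rw [this]
  field_simp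

lemma tendsto_integral_regDelta {φ : Plane → ℝ} (hφ : Continuous φ) (hs : HasCompactSupport φ)
    (y : Plane) :
    Tendsto (fun n => ∫ x, regDelta (regSeq n) (x - y) * φ x) atTop (𝓝 (logMass * φ y)) := by
  obtain ⟨M, hM⟩ := hφ.bounded_above_of_compact_support hs
  have h : ∀ n, ∫ x, regDelta (regSeq n) (x - y) * φ x =
      ∫ z, regDelta 1 z * φ (√(regSeq n) • z + y) := fun n => by
    rw [← integral_regDelta_sub_mul (Real.sqrt_pos.2 (regSeq_pos n)) φ y,
      Real.sq_sqrt (regSeq_pos n).le]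
  simp only [h]
  rw [logMass, ← integral_mul_const]
  refine tendsto_integral_of_dominated_convergence (fun z => regDelta 1 z * M) (fun n => ?_)
    (integrable_regDelta_one.mul_const M) (fun n => .of_forall fun z => ?_)
    (.of_forall fun z => ?_)
  · exact integrable_regDelta_one.aestronglyMeasurable.mul
      (hφ.comp (by fun_prop)).aestronglyMeasurable
  · rw [norm_mul, Real.norm_of_nonneg (regDelta_nonneg zero_le_one z)]
    exact mul_le_mul_of_nonneg_left (hM _) (regDelta_nonneg zero_le_one z)
  · have h1 : Tendsto (fun n => √(regSeq n)) atTop (𝓝 0) := by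
      simpa using tendsto_regSeq.sqrt
    have h2 : Tendsto (fun s : ℝ => regDelta 1 z * φ (s • z + y)) (𝓝 0)
        (𝓝 (regDelta 1 z * φ ((0 : ℝ) • z + y))) := by
      apply Continuous.tendsto
      fun_prop
    rw [zero_smul, zero_add] at h2
    exact h2.comp h1

/-- This lets the Laplacian of a test function play the role of the density, so that
`tendsto_regPot` applies to it. -/
lemma exists_isDecaying {G : Plane → ℝ} (hG : Continuous G) (hs : HasCompactSupport G) :
    ∃ C, IsDecaying C G := by
  have hc : Continuous fun y : Plane => (1 + ‖y‖) ^ (4 : ℝ) * G y := by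
    refine Continuous.mul (Continuous.rpow_const (by fun_prop) fun y => .inr (by norm_num)) hG
  obtain ⟨C, hC⟩ := hc.bounded_above_of_compact_support hs.mul_left
  refine ⟨C, hG.measurable, fun y => ?_⟩
  have h0 : 0 < 1 + ‖y‖ := by positivity
  have h := hC y
  rw [norm_mul, Real.norm_of_nonneg (by positivity), Real.norm_eq_abs] at h
  rw [Real.rpow_neg h0.le, ← div_eq_mul_inv, le_div_iff₀ (by positivity), mul_comm]
  exact h

/-- The logarithm is a multiple of the fundamental solution of the Laplacian. -/
lemma integral_log_mul_laplacian {φ : Plane → ℝ} (hφ : ContDiff ℝ 2 φ) (hs : HasCompactSupport φ)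
    (y : Plane) : ∫ x, Real.log ‖x - y‖ * Laplacian.laplacian φ x = logMass * φ y := by
  obtain ⟨C, hC⟩ := exists_isDecaying (continuous_laplacian hφ) (hasCompactSupport_laplacian hφ hs)
  have h1 := hC.tendsto_regPot y
  have h2 : ∀ n, regPot (regSeq n) (Laplacian.laplacian φ) y =
      ∫ x, regDelta (regSeq n) (x - y) * φ x := fun n => by
    have hF : ContDiff ℝ 2 (fun x => regLog (regSeq n) (x - y)) :=
      (contDiff_regLog (regSeq_pos n) (n := 2)).comp (by fun_prop)
    have := integral_mul_laplacian hF hφ hs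
    simp only [laplacian_regLog_sub (regSeq_pos n)] at this
    rw [← this, regPot]
    congr 1 with x
    rw [regLog, regLog, norm_sub_rev]
  simp only [h2] at h1
  -- The same regularised integrals converge to the potential of `Δφ` at `y` and, after Green's
  -- identity, to `logMass * φ y`.
  have h3 := tendsto_nhds_unique h1 (tendsto_integral_regDelta hφ.continuous hs y)
  rw [← h3, logPot]
  simp only [norm_sub_rev]

/-- The logarithmic potential solves Poisson's equation in the sense of distributions. -/
lemma IsDecaying.integral_logPot_mul_laplacian {C : ℝ} {H : Plane → ℝ} (hH : IsDecaying C H)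
    {φ : Plane → ℝ} (hφ : ContDiff ℝ 2 φ) (hs : HasCompactSupport φ) :
    ∫ x, logPot H x * Laplacian.laplacian φ x = logMass * ∫ y, H y * φ y := by
  have hL := continuous_laplacian hφ
  have hLs := hasCompactSupport_laplacian hφ hs
  have hint : Integrable (Function.uncurry fun x y : Plane =>
      Real.log ‖x - y‖ * H y * Laplacian.laplacian φ x) (volume.prod volume) := by
    have hm : AEStronglyMeasurable (Function.uncurry fun x y : Plane =>
        Real.log ‖x - y‖ * H y * Laplacian.laplacian φ x) (volume.prod volume) := by
      refine Measurable.aestronglyMeasurable ?_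
      refine Measurable.mul (Measurable.mul (Real.measurable_log.comp (by fun_prop))
        (hH.measurable.comp measurable_snd)) (hL.measurable.comp measurable_fst)
    rw [integrable_prod_iff hm]
    refine ⟨.of_forall fun x => (hH.integrable_log_mul x).mul_const (Laplacian.laplacian φ x), ?_⟩
    -- Fubini is justified by the majorant: its integral in `y` is affine in `‖x‖`, and `Δφ` has
    -- compact support.
    have hb : Integrable fun x : Plane => (C * (∫ y, singPart y) +
        (2 + ‖x‖) * (C * ∫ y : Plane, (1 + ‖y‖) ^ (-3 : ℝ))) * |Laplacian.laplacian φ x| := by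
      refine Continuous.integrable_of_hasCompactSupport (by fun_prop) ?_
      exact hLs.abs.mul_left
    refine hb.mono' hm.norm.integral_prod_right' (.of_forall fun x => ?_)
    rw [Real.norm_of_nonneg (integral_nonneg fun y => norm_nonneg _)]
    simp only [Function.uncurry_apply_pair, norm_mul _ (Laplacian.laplacian φ x),
      integral_mul_const, Real.norm_eq_abs (Laplacian.laplacian φ x)]
    refine mul_le_mul_of_nonneg_right ?_ (abs_nonneg _)
    rw [← integral_logMajorant]
    exact integral_mono (hH.integrable_log_mul x).norm (integrable_logMajorant C x)
      fun y => hH.log_mul_le x y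
  calc ∫ x, logPot H x * Laplacian.laplacian φ x
      = ∫ x, ∫ y, Real.log ‖x - y‖ * H y * Laplacian.laplacian φ x := by
        simp only [logPot, integral_mul_const]
    _ = ∫ y, ∫ x, Real.log ‖x - y‖ * H y * Laplacian.laplacian φ x := integral_integral_swap hint
    _ = ∫ y, logMass * (H y * φ y) := by
        congr 1 with y
        rw [show logMass * (H y * φ y) = H y * (logMass * φ y) by ring,
          ← integral_log_mul_laplacian hφ hs y, ← integral_const_mul]
        congr 1 with x
        ring
    _ = _ := integral_const_mul _ _

/-! ### Third differences -/

/-- The third forward difference. -/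
def thirdDiff {E : Type*} [AddCommGroup E] (F : E → ℝ) (x h : E) : ℝ :=
  F (x + h + h + h) - 3 * F (x + h + h) + 3 * F (x + h) - F x

lemma fwdDiff_iterate_three {E : Type*} [AddCommGroup E] (F : E → ℝ) (x h : E) :
    (fwdDiff h)^[3] F x = thirdDiff F x h := by
  simp only [Function.iterate_succ, Function.iterate_zero, Function.comp_apply, id, fwdDiff,
    thirdDiff]
  ring

lemma abs_sub_le_of_hasDerivAt {f f' : ℝ → ℝ} {a M : ℝ}
    (hf : ∀ t ∈ Icc a (a + 1), HasDerivAt f (f' t) t) (hM : ∀ t ∈ Icc a (a + 1), |f' t| ≤ M) :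
    |f (a + 1) - f a| ≤ M := by
  have h := (convex_Icc a (a + 1)).norm_image_sub_le_of_norm_hasDerivWithin_le
    (fun t ht => (hf t ht).hasDerivWithinAt) hM (left_mem_Icc.2 (by linarith))
    (right_mem_Icc.2 (by linarith))
  simpa using h

/-- Each unit difference costs one mean value inequality: the bound passes from `f₃` to the first
difference of `f₂`, the second of `f₁` and the third of `f`. -/
lemma abs_thirdDiff_le_of_hasDerivAt {f f₁ f₂ f₃ : ℝ → ℝ} {M : ℝ}
    (h₁ : ∀ t ∈ Icc (0 : ℝ) 3, HasDerivAt f (f₁ t) t)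
    (h₂ : ∀ t ∈ Icc (0 : ℝ) 3, HasDerivAt f₁ (f₂ t) t)
    (h₃ : ∀ t ∈ Icc (0 : ℝ) 3, HasDerivAt f₂ (f₃ t) t)
    (hM : ∀ t ∈ Icc (0 : ℝ) 3, |f₃ t| ≤ M) :
    |f 3 - 3 * f 2 + 3 * f 1 - f 0| ≤ M := by
  have s₁ : ∀ t ∈ Icc (0 : ℝ) 2, |f₂ (t + 1) - f₂ t| ≤ M := fun t ht =>
    abs_sub_le_of_hasDerivAt (fun s hs => h₃ s ⟨by linarith [ht.1, hs.1], by linarith [ht.2, hs.2]⟩)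
      (fun s hs => hM s ⟨by linarith [ht.1, hs.1], by linarith [ht.2, hs.2]⟩)
  have s₂ : ∀ t ∈ Icc (0 : ℝ) 1, |(f₁ (t + 1 + 1) - f₁ (t + 1)) - (f₁ (t + 1) - f₁ t)| ≤ M :=
    fun t ht => abs_sub_le_of_hasDerivAt (f := fun s => f₁ (s + 1) - f₁ s)
      (f' := fun s => f₂ (s + 1) - f₂ s)
      (fun s hs => HasDerivAt.sub
        ((h₂ (s + 1) ⟨by linarith [ht.1, hs.1], by linarith [ht.2, hs.2]⟩).comp_add_const s 1)
        (h₂ s ⟨by linarith [ht.1, hs.1], by linarith [ht.2, hs.2]⟩))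
      (fun s hs => s₁ s ⟨by linarith [ht.1, hs.1], by linarith [ht.2, hs.2]⟩)
  have s₃ := abs_sub_le_of_hasDerivAt (a := 0)
      (f := fun s => (f (s + 1 + 1) - f (s + 1)) - (f (s + 1) - f s))
      (f' := fun s => (f₁ (s + 1 + 1) - f₁ (s + 1)) - (f₁ (s + 1) - f₁ s))
      (fun s hs => by
        have hs0 := hs.1
        have hs1 := hs.2
        refine HasDerivAt.sub (HasDerivAt.sub ?_ ?_) (HasDerivAt.sub ?_ ?_)
        · have h := (h₁ (s + 1 + 1) ⟨by linarith, by linarith⟩)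
          exact (h.comp_add_const (s + 1) 1).comp_add_const s 1
        · exact (h₁ (s + 1) ⟨by linarith, by linarith⟩).comp_add_const s 1
        · exact (h₁ (s + 1) ⟨by linarith, by linarith⟩).comp_add_const s 1
        · exact h₁ s ⟨by linarith, by linarith⟩)
      (fun s hs => s₂ s (by simpa using hs))
  norm_num at s₃
  convert s₃ using 2
  ring

/-- The logarithm of the distance to the origin. -/
noncomputable def logNorm (z : Plane) : ℝ := Real.log ‖z‖

lemma abs_logNorm_le (z : Plane) : |logNorm z| ≤ singPart z + 1 + ‖z‖ :=
  (abs_log_le _ (norm_nonneg z)).trans (by linarith [norm_inv_le_singPart z])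

/-- Along the segment from `w` to `w + 3e` the function is half the logarithm of a quadratic
polynomial, and its third derivative is at most `14` divided by the cube of the distance to the
origin. -/
lemma abs_thirdDiff_logNorm_le_of_far {w e : Plane} (he : ‖e‖ = 1) (hw : 8 ≤ ‖w‖) :
    |thirdDiff logNorm w e| ≤ 112 * (1 + ‖w‖) ^ (-3 : ℝ) := by
  set a : ℝ := inner ℝ w e with ha
  set p : ℝ → ℝ := fun t => ‖w + t • e‖ ^ 2 with hp
  have hpe : ∀ t, p t = ‖w‖ ^ 2 + 2 * a * t + t ^ 2 := fun t => by
    simp only [hp]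
    rw [norm_add_sq_real, inner_smul_right, norm_smul, he, ← ha, mul_one, Real.norm_eq_abs, sq_abs]
    ring
  have hlow : ∀ t ∈ Icc (0 : ℝ) 3, ‖w‖ - 3 ≤ ‖w + t • e‖ := fun t ht => by
    have h := norm_sub_norm_le w (-(t • e))
    rw [sub_neg_eq_add, norm_neg, norm_smul, he, mul_one, Real.norm_of_nonneg ht.1] at h
    linarith [ht.2]
  have hpos : ∀ t ∈ Icc (0 : ℝ) 3, 0 < p t := fun t ht => by
    have := hlow t ht
    have : 0 < ‖w + t • e‖ := by linarith
    simp only [hp]; positivity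
  have hdp : ∀ t, HasDerivAt p (2 * (a + t)) t := fun t => by
    rw [show p = fun t => ‖w‖ ^ 2 + 2 * a * t + t ^ 2 from funext hpe]
    have := (((hasDerivAt_id t).const_mul (2 * a)).const_add (‖w‖ ^ 2)).add ((hasDerivAt_id t).pow 2)
    refine this.congr_deriv ?_
    simp; ring
  have hda : ∀ t, HasDerivAt (fun t => a + t) 1 t := fun t => (hasDerivAt_id t).const_add a
  have key := abs_thirdDiff_le_of_hasDerivAt (f := fun t => Real.log (p t) / 2)
    (f₁ := fun t => (a + t) / p t) (f₂ := fun t => 1 / p t - 2 * (a + t) ^ 2 / p t ^ 2)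
    (f₃ := fun t => -6 * (a + t) / p t ^ 2 + 8 * (a + t) ^ 3 / p t ^ 3)
    (M := 112 * (1 + ‖w‖) ^ (-3 : ℝ)) ?_ ?_ ?_ ?_
  · have hlog : ∀ t : ℝ, Real.log (p t) / 2 = logNorm (w + t • e) := fun t => by
      simp only [hp, logNorm, Real.log_pow]
      push_cast; ring
    simp only [hlog] at key
    have e1 : w + e + e + e = w + (3 : ℝ) • e := by module
    have e2 : w + e + e = w + (2 : ℝ) • e := by module
    rw [thirdDiff, e1, e2]
    simpa using key
  · intro t ht
    refine (((hdp t).log (hpos t ht).ne').div_const 2).congr_deriv ?_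
    have := (hpos t ht).ne'
    field_simp
  · intro t ht
    have := (hpos t ht).ne'
    refine ((hda t).div (hdp t) this).congr_deriv ?_
    field_simp
  · intro t ht
    have := (hpos t ht).ne'
    refine (((hasDerivAt_const t (1 : ℝ)).div (hdp t) this).sub
      ((((hda t).pow 2).const_mul 2).div ((hdp t).pow 2) (pow_ne_zero 2 this))).congr_deriv ?_
    simp only [Pi.pow_apply]
    field_simp
    push_cast
    ring
  · intro t ht
    have hl := hlow t ht
    set q := ‖w + t • e‖ with hq
    have hq0 : 0 < q := by linarith
    have hpq : p t = q ^ 2 := rfl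
    have hat : |a + t| ≤ q := by
      have h1 : a + t = inner ℝ (w + t • e) e := by
        rw [inner_add_left, inner_smul_left, real_inner_self_eq_norm_sq, he, ← ha]; simp
      rw [h1]
      simpa [he] using abs_real_inner_le_norm (w + t • e) e
    have h3 : (1 + ‖w‖) ^ (-3 : ℝ) = ((1 + ‖w‖) ^ 3)⁻¹ := by
      rw [Real.rpow_neg (by positivity)]; norm_cast
    rw [h3, hpq]
    have b1 : |-6 * (a + t) / (q ^ 2) ^ 2| ≤ 6 / q ^ 3 := by
      rw [abs_div, abs_mul, abs_of_pos (show 0 < (q ^ 2) ^ 2 by positivity),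
        div_le_div_iff₀ (by positivity) (by positivity)]
      norm_num
      nlinarith [mul_le_mul_of_nonneg_right hat (show 0 ≤ q ^ 3 by positivity)]
    have b2 : |8 * (a + t) ^ 3 / (q ^ 2) ^ 3| ≤ 8 / q ^ 3 := by
      rw [abs_div, abs_mul, abs_pow, abs_of_pos (show 0 < (q ^ 2) ^ 3 by positivity),
        div_le_div_iff₀ (by positivity) (by positivity)]
      have : |a + t| ^ 3 ≤ q ^ 3 := by gcongr
      norm_num
      nlinarith [mul_le_mul_of_nonneg_right this (show 0 ≤ q ^ 3 by positivity)]
    -- From `q ≥ ‖w‖ - 3` and `‖w‖ ≥ 8` follows `1 + ‖w‖ ≤ 2 q`, so `112 = 14 · 2³`.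
    have b3 : 14 / q ^ 3 ≤ 112 * ((1 + ‖w‖) ^ 3)⁻¹ := by
      rw [← div_eq_mul_inv, div_le_div_iff₀ (by positivity) (by positivity)]
      have : (1 + ‖w‖) ^ 3 ≤ (2 * q) ^ 3 := by gcongr; linarith
      nlinarith
    calc _ ≤ _ := abs_add_le _ _
      _ ≤ 6 / q ^ 3 + 8 / q ^ 3 := add_le_add b1 b2
      _ = 14 / q ^ 3 := by ring
      _ ≤ _ := b3

/-- An integrable majorant for the third difference of the logarithm with a unit step. -/
noncomputable def stepMajorant (e w : Plane) : ℝ :=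
  singPart (w + (3 : ℝ) • e) + 3 * singPart (w + (2 : ℝ) • e) + 3 * singPart (w + e) + singPart w +
    70000 * (1 + ‖w‖) ^ (-3 : ℝ)

lemma integrable_stepMajorant (e : Plane) : Integrable (stepMajorant e) :=
  ((((integrable_singPart.comp_add_right _).add
    ((integrable_singPart.comp_add_right _).const_mul 3)).add
    ((integrable_singPart.comp_add_right _).const_mul 3)).add integrable_singPart).add
    (integrable_decay_three.const_mul _)

lemma integral_stepMajorant (e : Plane) : ∫ w, stepMajorant e w =
    8 * (∫ z, singPart z) + 70000 * ∫ w : Plane, (1 + ‖w‖) ^ (-3 : ℝ) := by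
  have i1 := fun v : Plane => integrable_singPart.comp_add_right v
  unfold stepMajorant
  rw [integral_add _ (integrable_decay_three.const_mul _), integral_add _ integrable_singPart,
    integral_add _ ((i1 _).const_mul 3), integral_add (i1 _) ((i1 _).const_mul 3)]
  · simp only [integral_const_mul, integral_add_right_eq_self]
    ring
  · exact (i1 _).add ((i1 _).const_mul 3)
  · exact ((i1 _).add ((i1 _).const_mul 3)).add ((i1 _).const_mul 3)
  · exact (((i1 _).add ((i1 _).const_mul 3)).add ((i1 _).const_mul 3)).add integrable_singPart

lemma abs_thirdDiff_logNorm_le_stepMajorant {w e : Plane} (he : ‖e‖ = 1) :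
    |thirdDiff logNorm w e| ≤ stepMajorant e w := by
  have hs := singPart_nonneg
  have hd : 0 ≤ (1 + ‖w‖) ^ (-3 : ℝ) := by positivity
  rcases le_or_gt 8 ‖w‖ with hw | hw
  · refine (abs_thirdDiff_logNorm_le_of_far he hw).trans ?_
    unfold stepMajorant
    linarith [hs (w + (3 : ℝ) • e), hs (w + (2 : ℝ) • e), hs (w + e), hs w]
  · have e1 : w + e + e + e = w + (3 : ℝ) • e := by module
    have e2 : w + e + e = w + (2 : ℝ) • e := by module
    have n3 := norm_add_le w ((3 : ℝ) • e)
    have n2 := norm_add_le w ((2 : ℝ) • e)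
    have n1 := norm_add_le w e
    rw [norm_smul, he] at n3 n2
    rw [he] at n1
    norm_num at n3 n2
    have a3 := abs_le.1 (abs_logNorm_le (w + (3 : ℝ) • e))
    have a2 := abs_le.1 (abs_logNorm_le (w + (2 : ℝ) • e))
    have a1 := abs_le.1 (abs_logNorm_le (w + e))
    have a0 := abs_le.1 (abs_logNorm_le w)
    have h3 : (1 + ‖w‖) ^ (-3 : ℝ) = ((1 + ‖w‖) ^ 3)⁻¹ := by
      rw [Real.rpow_neg (by positivity)]; norm_cast
    -- For `‖w‖ < 8` the nonsingular parts of the four logarithms, weighted `1, 3, 3, 1`, total at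
    -- most `8 + 8 · 8 + 12 = 84`, while `70000 / 9³ > 96`.
    have h4 : 96 ≤ 70000 * (1 + ‖w‖) ^ (-3 : ℝ) := by
      rw [h3, ← div_eq_mul_inv, le_div_iff₀ (by positivity)]
      have : (1 + ‖w‖) ^ 3 ≤ (9 : ℝ) ^ 3 := by gcongr; linarith
      norm_num at this
      linarith
    rw [thirdDiff, e1, e2, stepMajorant, abs_le]
    constructor <;> linarith

lemma logNorm_smul {r : ℝ} (hr : 0 < r) {z : Plane} (hz : z ≠ 0) :
    logNorm (r • z) = Real.log r + logNorm z := by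
  rw [logNorm, norm_smul, Real.norm_of_nonneg hr.le,
    Real.log_mul hr.ne' (norm_ne_zero_iff.2 hz), logNorm]

/-- Dilation adds the constant `log r`, which differences annihilate. The four points must avoid the
origin because of the convention `log 0 = 0`. -/
lemma thirdDiff_logNorm_smul {r : ℝ} (hr : 0 < r) {z e : Plane} (h0 : z ≠ 0) (h1 : z + e ≠ 0)
    (h2 : z + e + e ≠ 0) (h3 : z + e + e + e ≠ 0) :
    thirdDiff logNorm (r • z) (r • e) = thirdDiff logNorm z e := by
  simp only [thirdDiff, ← smul_add, logNorm_smul hr, h0, h1, h2, h3, ne_eq, not_false_eq_true]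
  ring

/-- Potentials of bounded densities have third differences of second order. -/
lemma IsDecaying.exists_abs_thirdDiff_logPot_le {C : ℝ} {H : Plane → ℝ} (hH : IsDecaying C H) :
    ∃ K, ∀ x h, |thirdDiff (logPot H) x h| ≤ K * ‖h‖ ^ 2 := by
  refine ⟨C * (8 * (∫ z, singPart z) + 70000 * ∫ w : Plane, (1 + ‖w‖) ^ (-3 : ℝ)), fun x h => ?_⟩
  rcases eq_or_ne h 0 with rfl | hh
  · simp [thirdDiff]
  set r := ‖h‖ with hr
  have hr0 : 0 < r := norm_pos_iff.2 hh
  set e := r⁻¹ • h with he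
  have he1 : ‖e‖ = 1 := by
    rw [he, norm_smul, Real.norm_of_nonneg (by positivity), ← hr, inv_mul_cancel₀ hr0.ne']
  have hre : r • e = h := by rw [he, smul_inv_smul₀ hr0.ne']
  have hint := fun z => hH.integrable_log_mul z
  have hrep : thirdDiff (logPot H) x h = ∫ y, thirdDiff logNorm (x - y) h * H y := by
    simp only [thirdDiff, logPot]
    rw [← integral_const_mul, ← integral_const_mul, ← integral_sub (hint _) ((hint _).const_mul 3),
      ← integral_add, ← integral_sub _ (hint _)]
    · congr 1 with y
      simp only [logNorm]
      rw [show x - y + h + h + h = x + h + h + h - y by abel,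
        show x - y + h + h = x + h + h - y by abel, show x - y + h = x + h - y by abel]
      ring
    · exact ((hint _).sub ((hint _).const_mul 3)).add ((hint _).const_mul 3)
    · exact (hint _).sub ((hint _).const_mul 3)
    · exact (hint _).const_mul 3
  have hmaj : Integrable fun y => stepMajorant e (r⁻¹ • (x - y)) :=
    ((integrable_stepMajorant e).comp_smul (inv_ne_zero hr0.ne')).comp_sub_left x
  -- After rescaling to a unit step, the planar change of variables produces exactly the factor `‖h‖
  -- ^ 2`.
  have hmi : ∫ y, stepMajorant e (r⁻¹ • (x - y)) = r ^ 2 * ∫ w, stepMajorant e w := by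
    rw [integral_sub_left_eq_self (fun z => stepMajorant e (r⁻¹ • z)) volume x,
      Measure.integral_comp_smul, finrank_plane, smul_eq_mul, inv_pow, inv_inv,
      abs_of_pos (by positivity)]
  rw [hrep, show C * _ * r ^ 2 = ∫ y, C * stepMajorant e (r⁻¹ • (x - y)) by
    rw [integral_const_mul, hmi, integral_stepMajorant]; ring]
  rw [← Real.norm_eq_abs]
  refine norm_integral_le_of_norm_le (hmaj.const_mul C) ?_
  filter_upwards [ae_ne_plane x, ae_ne_plane (x + h), ae_ne_plane (x + h + h),
    ae_ne_plane (x + h + h + h)] with y h0 h1 h2 h3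
  have hz : ∀ v : Plane, v - y ≠ 0 → r⁻¹ • (v - y) ≠ 0 := fun v hv =>
    smul_ne_zero (inv_ne_zero hr0.ne') hv
  have hst : thirdDiff logNorm (x - y) h = thirdDiff logNorm (r⁻¹ • (x - y)) e := by
    rw [← thirdDiff_logNorm_smul hr0 (z := r⁻¹ • (x - y)) (e := e), hre, smul_inv_smul₀ hr0.ne']
    · exact hz _ (sub_ne_zero.2 h0.symm)
    · rw [he, ← smul_add, sub_add_eq_add_sub]
      exact hz _ (sub_ne_zero.2 h1.symm)
    · rw [he, ← smul_add, ← smul_add, sub_add_eq_add_sub, sub_add_eq_add_sub]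
      exact hz _ (sub_ne_zero.2 h2.symm)
    · rw [he, ← smul_add, ← smul_add, ← smul_add, sub_add_eq_add_sub, sub_add_eq_add_sub,
        sub_add_eq_add_sub]
      exact hz _ (sub_ne_zero.2 h3.symm)
  rw [norm_mul, hst, mul_comm, Real.norm_eq_abs, Real.norm_eq_abs]
  exact mul_le_mul (hH.abs_le y) (abs_thirdDiff_logNorm_le_stepMajorant he1) (abs_nonneg _)
    hH.nonneg

/-- Smooth functions with compact support have third differences of second order. -/
lemma exists_abs_thirdDiff_le_of_contDiff {F : Plane → ℝ} (hF : ContDiff ℝ 2 F)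
    (hs : HasCompactSupport F) : ∃ K, ∀ x h, |thirdDiff F x h| ≤ K * ‖h‖ ^ 2 := by
  have hF1 : ContDiff ℝ 1 (fderiv ℝ F) := hF.fderiv_right (by norm_num)
  obtain ⟨L, hL⟩ := hF1.lipschitzWith_of_hasCompactSupport (hs.fderiv (𝕜 := ℝ)) (by norm_num)
  have hd : Differentiable ℝ F := hF.differentiable (by norm_num)
  have second : ∀ x h, |F (x + h + h) - F (x + h) - (F (x + h) - F x)| ≤ L * ‖h‖ ^ 2 := by
    intro x h
    have hder : ∀ z ∈ (univ : Set Plane), HasFDerivWithinAt (fun z => F (z + h) - F z)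
        (fderiv ℝ F (z + h) - fderiv ℝ F z) univ z := fun z _ => by
      have h1 : HasFDerivAt (fun z => F (z + h)) (fderiv ℝ F (z + h)) z :=
        (hasFDerivAt_comp_add_right h).2 (hd (z + h)).hasFDerivAt
      exact (h1.sub (hd z).hasFDerivAt).hasFDerivWithinAt
    have := convex_univ.norm_image_sub_le_of_norm_hasFDerivWithin_le hder
      (C := L * ‖h‖) (fun z _ => by
        rw [← dist_eq_norm]
        simpa using hL.dist_le_mul (z + h) z) (mem_univ x) (mem_univ (x + h))
    rw [add_sub_cancel_left, Real.norm_eq_abs] at this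
    linarith
  -- The third difference is the difference of two consecutive second differences.
  refine ⟨2 * L, fun x h => ?_⟩
  have a1 := abs_le.1 (second (x + h) h)
  have a2 := abs_le.1 (second x h)
  rw [thirdDiff, abs_le]
  constructor <;> linarith

/-! ### Reflections and the inversion in the unit circle -/

/-- The reflection changing the sign of the `i`-th coordinate. -/
noncomputable def coordReflect (i : Fin 2) : Plane ≃ₗᵢ[ℝ] Plane :=
  LinearIsometryEquiv.piLpCongrRight 2
    (fun j => if j = i then LinearIsometryEquiv.neg ℝ else LinearIsometryEquiv.refl ℝ ℝ)

lemma coordReflect_apply (i j : Fin 2) (x : Plane) :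
    coordReflect i x j = if j = i then -x j else x j := by
  unfold coordReflect
  rw [LinearIsometryEquiv.piLpCongrRight_apply]
  split_ifs with h <;> simp [h]

lemma coordReflect_coordReflect (i : Fin 2) (x : Plane) :
    coordReflect i (coordReflect i x) = x := by
  ext j
  simp only [coordReflect_apply]
  split_ifs <;> simp

/-- The inversion in the unit circle. -/
noncomputable def circleInv (y : Plane) : Plane := (‖y‖ ^ 2)⁻¹ • y

lemma circleInv_eq_inversion : circleInv = EuclideanGeometry.inversion (0 : Plane) 1 := by
  ext1 y
  simp [circleInv, EuclideanGeometry.inversion]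

lemma norm_circleInv (y : Plane) : ‖circleInv y‖ = ‖y‖⁻¹ := by
  rcases eq_or_ne y 0 with rfl | hy
  · simp [circleInv]
  have := norm_pos_iff.2 hy
  rw [circleInv, norm_smul, Real.norm_of_nonneg (by positivity)]
  field_simp

lemma circleInv_circleInv (y : Plane) : circleInv (circleInv y) = y := by
  rcases eq_or_ne y 0 with rfl | hy
  · simp [circleInv]
  rw [circleInv_eq_inversion, EuclideanGeometry.inversion_inversion _ one_ne_zero]

lemma circleInv_ne_zero {y : Plane} (hy : y ≠ 0) : circleInv y ≠ 0 := by
  rw [← norm_ne_zero_iff, norm_circleInv]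
  exact inv_ne_zero (norm_ne_zero_iff.2 hy)

lemma measurable_circleInv : Measurable circleInv := by unfold circleInv; fun_prop

lemma circleInv_coordReflect (i : Fin 2) (y : Plane) :
    circleInv (coordReflect i y) = coordReflect i (circleInv y) := by
  simp [circleInv]

lemma norm_sub_circleInv {x y : Plane} (hx : x ≠ 0) (hy : y ≠ 0) :
    ‖circleInv x - circleInv y‖ = ‖x - y‖ / (‖x‖ * ‖y‖) := by
  rw [circleInv_eq_inversion, ← dist_eq_norm, EuclideanGeometry.dist_inversion_inversion hx hy]
  simp [dist_eq_norm]
  ring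

/-- The inversion is conformal: its derivative is `‖y‖⁻²` times a reflection, so in the plane the
Jacobian is `‖y‖⁻⁴`. -/
lemma abs_det_fderiv_circleInv (y : Plane) :
    |(((1 / dist y 0) ^ 2 • ((ℝ ∙ (y - 0))ᗮ.reflection : Plane →L[ℝ] Plane)) :
      Plane →L[ℝ] Plane).det| = ‖y‖⁻¹ ^ 4 := by
  rw [ContinuousLinearMap.det, ContinuousLinearMap.toLinearMap_smul, LinearMap.det_smul,
    finrank_plane, abs_mul]
  have : |LinearMap.det (((ℝ ∙ (y - 0))ᗮ.reflection : Plane →L[ℝ] Plane) : Plane →ₗ[ℝ] Plane)| = 1 :=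
    by
    have h := Submodule.det_reflection (ℝ ∙ (y - 0))ᗮ
    refine (congrArg abs h).trans ?_
    rw [abs_pow, abs_neg, abs_one, one_pow]
  rw [this, mul_one, dist_zero_right, one_div, abs_of_nonneg (by positivity)]
  ring

lemma image_circleInv_compl : circleInv '' ({0}ᶜ : Set Plane) = {0}ᶜ := by
  ext y
  constructor
  · rintro ⟨x, hx, rfl⟩
    exact circleInv_ne_zero hx
  · intro hy
    exact ⟨circleInv y, circleInv_ne_zero hy, circleInv_circleInv y⟩

lemma ae_restrict_compl_zero :
    (volume.restrict ({0}ᶜ : Set Plane)) = volume :=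
  Measure.restrict_eq_self_of_ae_mem (ae_ne_plane 0)

lemma hasFDerivWithinAt_circleInv (y : Plane) (hy : y ∈ ({0}ᶜ : Set Plane)) :
    HasFDerivWithinAt circleInv
      ((1 / dist y 0) ^ 2 • ((ℝ ∙ (y - 0))ᗮ.reflection : Plane →L[ℝ] Plane)) {0}ᶜ y := by
  rw [circleInv_eq_inversion]
  exact (EuclideanGeometry.hasFDerivAt_inversion hy).hasFDerivWithinAt

lemma injOn_circleInv : InjOn circleInv ({0}ᶜ : Set Plane) := fun x _ y _ h => by
  rw [← circleInv_circleInv x, h, circleInv_circleInv]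

lemma integral_comp_circleInv (F : Plane → ℝ) :
    ∫ y, ‖y‖⁻¹ ^ 4 * F (circleInv y) = ∫ y, F y := by
  have h := integral_image_eq_integral_abs_det_fderiv_smul volume
    (measurableSet_singleton (0 : Plane)).compl hasFDerivWithinAt_circleInv injOn_circleInv F
  rw [image_circleInv_compl, ae_restrict_compl_zero] at h
  rw [h]
  simp only [abs_det_fderiv_circleInv, smul_eq_mul]

lemma integrable_comp_circleInv {F : Plane → ℝ} :
    Integrable (fun y => ‖y‖⁻¹ ^ 4 * F (circleInv y)) ↔ Integrable F := by
  have h := integrableOn_image_iff_integrableOn_abs_det_fderiv_smul volume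
    (measurableSet_singleton (0 : Plane)).compl hasFDerivWithinAt_circleInv injOn_circleInv F
  rw [image_circleInv_compl, IntegrableOn, IntegrableOn, ae_restrict_compl_zero] at h
  rw [h]
  simp only [abs_det_fderiv_circleInv, smul_eq_mul]

/-! ### Densities that are odd under the reflections and the inversion -/

/-- Densities that are odd in each coordinate and odd under the Kelvin transform. -/
structure IsKelvinOdd (H : Plane → ℝ) : Prop where
  reflect : ∀ i y, H (coordReflect i y) = -H y
  kelvin : ∀ y, y ≠ 0 → H (circleInv y) = -(‖y‖ ^ 4 * H y)

/-- The maps that a Kelvin-odd density is odd under, as far as integration is concerned. -/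
def IsOddMap (H : Plane → ℝ) (τ : Plane → Plane) : Prop :=
  ∀ F : Plane → ℝ, Integrable (fun y => F y * H y) →
    Integrable (fun y => F (τ y) * H y) ∧ ∫ y, F (τ y) * H y = -∫ y, F y * H y

namespace IsKelvinOdd

variable {H : Plane → ℝ}

lemma isOddMap_coordReflect (hH : IsKelvinOdd H) (i : Fin 2) : IsOddMap H (coordReflect i) := by
  intro F hF
  have hm := (coordReflect i).measurePreserving
  have he : (fun y => F (coordReflect i y) * H y) =
      fun y => -(fun z => F z * H z) (coordReflect i y) := by
    ext y
    simp only [hH.reflect]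
    ring
  rw [he]
  refine ⟨(hm.integrable_comp_of_integrable hF).neg, ?_⟩
  rw [integral_neg, hm.integral_comp (coordReflect i).toHomeomorph.measurableEmbedding
    (fun z => F z * H z)]

/-- The weight in the Kelvin condition is the one that cancels the Jacobian, so the signed measure
with density `H` is carried to its negative. -/
lemma isOddMap_circleInv (hH : IsKelvinOdd H) : IsOddMap H circleInv := by
  intro F hF
  have he : (fun y => -(‖y‖⁻¹ ^ 4 * (fun z => F z * H z) (circleInv y))) =ᵐ[volume]
      fun y => F (circleInv y) * H y := by
    filter_upwards [ae_ne_plane 0] with y hy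
    have := norm_ne_zero_iff.2 hy
    simp only [hH.kelvin y hy]
    field_simp
  refine ⟨((integrable_comp_circleInv (F := fun z => F z * H z)).2 hF).neg.congr he, ?_⟩
  rw [← integral_congr_ae he, integral_neg, integral_comp_circleInv (fun z => F z * H z)]

end IsKelvinOdd

/-- An odd symmetry of the density is transferred to the kernel at the price of a factor `2`; three
such transfers give the `8` in `integral_oddKernel`. -/
lemma IsOddMap.integral_sub {H : Plane → ℝ} {τ : Plane → Plane} (hτ : IsOddMap H τ)
    {F : Plane → ℝ} (hF : Integrable (fun y => F y * H y)) :
    Integrable (fun y => (F y - F (τ y)) * H y) ∧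
      ∫ y, (F y - F (τ y)) * H y = 2 * ∫ y, F y * H y := by
  obtain ⟨h1, h2⟩ := hτ F hF
  simp only [sub_mul]
  refine ⟨hF.sub h1, ?_⟩
  rw [MeasureTheory.integral_sub hF h1, h2]
  ring

lemma IsOddMap.integral_eq_zero {H : Plane → ℝ} {τ : Plane → Plane} (hτ : IsOddMap H τ)
    {F : Plane → ℝ} (hF : Integrable (fun y => F y * H y)) (hFτ : ∀ y, F (τ y) = F y) :
    ∫ y, F y * H y = 0 := by
  have h := (hτ F hF).2
  simp only [hFτ] at h
  linarith

/-! ### The antisymmetrised kernel and the symmetries of the potential -/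

/-- Antisymmetrisation of a function with respect to the four reflections. -/
noncomputable def oddPart (F : Plane → ℝ) (y : Plane) : ℝ :=
  F y - F (coordReflect 0 y) - (F (coordReflect 1 y) - F (coordReflect 0 (coordReflect 1 y)))

/-- Antisymmetrisation of the logarithmic kernel. -/
noncomputable def oddKernel (x y : Plane) : ℝ :=
  oddPart (fun z => Real.log ‖x - z‖) y - oddPart (fun z => Real.log ‖x - z‖) (circleInv y)

lemma integral_oddKernel {C : ℝ} {H : Plane → ℝ} (hC : IsDecaying C H) (hH : IsKelvinOdd H)
    (x : Plane) : Integrable (fun y => oddKernel x y * H y) ∧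
      ∫ y, oddKernel x y * H y = 8 * logPot H x := by
  have h0 := (hH.isOddMap_coordReflect 0).integral_sub (hC.integrable_log_mul x)
  have h1 := (hH.isOddMap_coordReflect 1).integral_sub h0.1
  have h2 := hH.isOddMap_circleInv.integral_sub h1.1
  refine ⟨h2.1, h2.2.trans ?_⟩
  rw [h1.2, h0.2, logPot]
  ring

lemma logPot_coordReflect {H : Plane → ℝ} {C : ℝ} (hC : IsDecaying C H) (hH : IsKelvinOdd H)
    (i : Fin 2) (x : Plane) : logPot H (coordReflect i x) = -logPot H x := by
  rw [logPot, logPot, ← (hH.isOddMap_coordReflect i _ (hC.integrable_log_mul x)).2]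
  congr 1 with y
  congr 2
  rw [← (coordReflect i).norm_map (x - _), map_sub, coordReflect_coordReflect]

/-- The inversion divides `‖x - y‖` by `‖x‖ ‖y‖`. The resulting terms `log ‖x‖` and `log ‖y‖` are
even under reflection in `y`, so they integrate to zero against the odd density. -/
lemma logPot_circleInv {H : Plane → ℝ} {C : ℝ} (hC : IsDecaying C H) (hH : IsKelvinOdd H)
    {x : Plane} (hx : x ≠ 0) : logPot H (circleInv x) = -logPot H x := by
  have i1 := hC.integrable_log_mul x
  have i2 : Integrable fun y => Real.log ‖y‖ * H y := by simpa using hC.integrable_log_mul 0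
  have i3 : Integrable fun y => Real.log ‖x‖ * H y := hC.integrable.const_mul _
  have z2 : ∫ y, Real.log ‖y‖ * H y = 0 :=
    (hH.isOddMap_coordReflect 0).integral_eq_zero (F := fun y => Real.log ‖y‖) i2 (by simp)
  have z3 : ∫ y, Real.log ‖x‖ * H y = 0 :=
    (hH.isOddMap_coordReflect 0).integral_eq_zero (F := fun _ => Real.log ‖x‖) i3 (by simp)
  have h1 := (hH.isOddMap_circleInv _ (hC.integrable_log_mul (circleInv x))).2
  have h2 : ∫ y, Real.log ‖circleInv x - circleInv y‖ * H y =
      ∫ y, (Real.log ‖x - y‖ * H y - Real.log ‖x‖ * H y - Real.log ‖y‖ * H y) := by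
    refine integral_congr_ae ?_
    filter_upwards [ae_ne_plane 0, ae_ne_plane x] with y hy hyx
    have hxn := norm_ne_zero_iff.2 hx
    have hyn := norm_ne_zero_iff.2 hy
    have hxy := norm_ne_zero_iff.2 (sub_ne_zero.2 hyx.symm)
    rw [norm_sub_circleInv hx hy, Real.log_div hxy (mul_ne_zero hxn hyn), Real.log_mul hxn hyn]
    ring
  have h3 : ∫ y, (Real.log ‖x - y‖ * H y - Real.log ‖x‖ * H y - Real.log ‖y‖ * H y) =
      (∫ y, (Real.log ‖x - y‖ * H y - Real.log ‖x‖ * H y)) - ∫ y, Real.log ‖y‖ * H y :=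
    integral_sub (i1.sub i3) i2
  rw [h2, h3, integral_sub i1 i3, z2, z3] at h1
  rw [logPot, logPot]
  linarith

/-- Points of the unit circle are fixed by the inversion, under which the potential is odd: this is
the Dirichlet condition. -/
lemma logPot_eq_zero {H : Plane → ℝ} {C : ℝ} (hC : IsDecaying C H) (hH : IsKelvinOdd H)
    {x : Plane} (hx : ‖x‖ = 1) : logPot H x = 0 := by
  have h0 : x ≠ 0 := norm_ne_zero_iff.1 (by rw [hx]; exact one_ne_zero)
  have h := logPot_circleInv hC hH h0
  rw [show circleInv x = x by simp [circleInv, hx]] at h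
  linarith

lemma IsDecaying.abs_logPot_le_of_mem {C : ℝ} {H : Plane → ℝ} (hH : IsDecaying C H) {x : Plane}
    (hx : ‖x‖ ≤ 1) : |logPot H x| ≤
      C * ((∫ y, singPart y) + 3 * ∫ y : Plane, (1 + ‖y‖) ^ (-3 : ℝ)) := by
  refine (hH.abs_logPot_le x).trans ?_
  have h0 : 0 ≤ ∫ y : Plane, (1 + ‖y‖) ^ (-3 : ℝ) := integral_nonneg fun y => by positivity
  have h1 := mul_le_mul_of_nonneg_right (show 2 + ‖x‖ ≤ 3 by linarith) (mul_nonneg hH.nonneg h0)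
  linarith

/-- Inversion symmetry carries the bound in the disc to the exterior; boundedness on the whole plane
is part of the Besov condition. -/
lemma exists_abs_logPot_le {H : Plane → ℝ} {C : ℝ} (hC : IsDecaying C H) (hH : IsKelvinOdd H) :
    ∃ M, ∀ x, |logPot H x| ≤ M := by
  refine ⟨C * ((∫ y, singPart y) + 3 * ∫ y : Plane, (1 + ‖y‖) ^ (-3 : ℝ)), fun x => ?_⟩
  rcases le_or_gt ‖x‖ 1 with hx | hx
  · exact hC.abs_logPot_le_of_mem hx
  · have h0 : x ≠ 0 := norm_pos_iff.1 (by linarith)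
    rw [← abs_neg, ← logPot_circleInv hC hH h0]
    refine hC.abs_logPot_le_of_mem ?_
    rw [norm_circleInv]
    exact inv_le_one_of_one_le₀ hx.le

/-! ### The sign of the antisymmetrised kernel -/

lemma ae_forall_reflections_ne (w : Plane) : ∀ᵐ y : Plane, y ≠ w ∧ coordReflect 0 y ≠ w ∧
    coordReflect 1 y ≠ w ∧ coordReflect 0 (coordReflect 1 y) ≠ w := by
  filter_upwards [ae_ne_plane w, ae_ne_plane (coordReflect 0 w), ae_ne_plane (coordReflect 1 w),
    ae_ne_plane (coordReflect 1 (coordReflect 0 w))] with y h h0 h1 h2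
  refine ⟨h, fun e => h0 ?_, fun e => h1 ?_, fun e => h2 ?_⟩ <;>
    rw [← e] <;> simp only [coordReflect_coordReflect]

lemma log_norm_sub_eq (x z : Plane) : Real.log ‖x - z‖ = Real.log (‖x - z‖ ^ 2) / 2 := by
  rw [Real.log_pow]; push_cast; ring

/-- The square of the distance to the inverted point, rescaled to a polynomial. -/
noncomputable def invDistSq (x z : Plane) : ℝ := ‖x‖ ^ 2 * ‖z‖ ^ 2 - 2 * (x 0 * z 0 + x 1 * z 1) + 1

lemma norm_sub_circleInv_sq (x : Plane) {z : Plane} (hz : z ≠ 0) :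
    ‖x - circleInv z‖ ^ 2 = invDistSq x z / ‖z‖ ^ 2 := by
  have hz' : 0 < ‖z‖ ^ 2 := by have := norm_pos_iff.2 hz; positivity
  have hzz := norm_sq_plane z
  rw [eq_div_iff hz'.ne', norm_sq_plane (x - circleInv z), invDistSq, norm_sq_plane x]
  simp only [PiLp.sub_apply, circleInv, PiLp.smul_apply, smul_eq_mul]
  rw [hzz] at hz' ⊢
  field_simp
  ring

lemma log_norm_sub_circleInv_eq {x z : Plane} (hz : z ≠ 0) (hxz : x ≠ circleInv z) :
    0 < invDistSq x z ∧ Real.log ‖x - circleInv z‖ =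
      (Real.log (invDistSq x z) - Real.log (‖z‖ ^ 2)) / 2 := by
  have hz' : 0 < ‖z‖ ^ 2 := by have := norm_pos_iff.2 hz; positivity
  have h := norm_sub_circleInv_sq x hz
  have hx : 0 < ‖x - circleInv z‖ ^ 2 := by
    have := norm_pos_iff.2 (sub_ne_zero.2 hxz); positivity
  have hp : 0 < invDistSq x z := by
    rw [h] at hx
    exact (div_pos_iff_of_pos_right hz').1 hx
  refine ⟨hp, ?_⟩
  rw [log_norm_sub_eq, h, Real.log_div hp.ne' hz'.ne']

/-- Almost everywhere the antisymmetrised kernel is half the logarithm of a quotient of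
polynomials whose difference factors. -/
lemma ae_oddKernel_eq (x : Plane) : ∀ᵐ y : Plane, ∃ X Y : ℝ, 0 < X ∧ 0 < Y ∧
    oddKernel x y = (Real.log X - Real.log Y) / 2 ∧
    Y - X = 16 * (x 0 * x 1 * (y 0 * y 1)) * (1 - ‖x‖ ^ 4) * (1 - ‖y‖ ^ 4) ∧
    (‖x‖ ≤ ‖y‖ → ‖y‖ ≤ 1 → Y ≤ 16 * ‖y‖ ^ 4) := by
  filter_upwards [ae_ne_plane 0, ae_forall_reflections_ne x,
    ae_forall_reflections_ne (circleInv x)] with y hy ⟨a0, a1, a2, a3⟩ ⟨b0, b1, b2, b3⟩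
  have hne : ∀ i, ∀ z : Plane, z ≠ 0 → coordReflect i z ≠ 0 := fun i z hz => by
    simpa using hz
  have hcirc : ∀ {z : Plane}, z ≠ circleInv x → x ≠ circleInv z := fun {z} h e => h (by
    rw [e, circleInv_circleInv])
  obtain ⟨c0, d0⟩ := log_norm_sub_circleInv_eq hy (hcirc b0)
  obtain ⟨c1, d1⟩ := log_norm_sub_circleInv_eq (hne 0 _ hy) (hcirc b1)
  obtain ⟨c2, d2⟩ := log_norm_sub_circleInv_eq (hne 1 _ hy) (hcirc b2)
  obtain ⟨c3, d3⟩ := log_norm_sub_circleInv_eq (hne 0 _ (hne 1 _ hy)) (hcirc b3)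
  have hpos : ∀ {z : Plane}, z ≠ x → 0 < ‖x - z‖ ^ 2 := fun {z} h => by
    have := norm_pos_iff.2 (sub_ne_zero.2 h.symm); positivity
  have p0 := hpos a0
  have p1 := hpos a1
  have p2 := hpos a2
  have p3 := hpos a3
  -- `X` collects the points and images that enter with a plus sign, `Y` the others. The normalising
  -- factors `‖z‖²` of the images cancel because reflections preserve the norm.
  refine ⟨‖x - y‖ ^ 2 * ‖x - coordReflect 0 (coordReflect 1 y)‖ ^ 2 *
      (invDistSq x (coordReflect 0 y) * invDistSq x (coordReflect 1 y)),
    ‖x - coordReflect 0 y‖ ^ 2 * ‖x - coordReflect 1 y‖ ^ 2 *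
      (invDistSq x y * invDistSq x (coordReflect 0 (coordReflect 1 y))),
    by positivity, by positivity, ?_, ?_, ?_⟩
  · rw [Real.log_mul (by positivity) (by positivity), Real.log_mul p0.ne' p3.ne',
      Real.log_mul c1.ne' c2.ne', Real.log_mul (by positivity) (by positivity),
      Real.log_mul p1.ne' p2.ne', Real.log_mul c0.ne' c3.ne', oddKernel, oddPart, oddPart]
    simp only [← circleInv_coordReflect]
    rw [d0, d1, d2, d3, log_norm_sub_eq x y, log_norm_sub_eq x (coordReflect 0 y),
      log_norm_sub_eq x (coordReflect 1 y), log_norm_sub_eq x (coordReflect 0 (coordReflect 1 y))]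
    simp only [LinearIsometryEquiv.norm_map]
    ring
  -- This factorisation replaces the maximum principle: every sign change of the kernel is visible
  -- as a vanishing factor on an axis or on the unit circle.
  · rw [show ‖x‖ ^ 4 = (‖x‖ ^ 2) ^ 2 by ring, show ‖y‖ ^ 4 = (‖y‖ ^ 2) ^ 2 by ring]
    simp only [invDistSq, norm_sq_plane, PiLp.sub_apply, coordReflect_apply]
    simp
    ring
  · intro hxy hy1
    have e1 : ‖x - coordReflect 0 y‖ ^ 2 * ‖x - coordReflect 1 y‖ ^ 2 =
        (‖x‖ ^ 2 + ‖y‖ ^ 2) ^ 2 - 4 * (x 0 * y 0 - x 1 * y 1) ^ 2 := by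
      simp only [norm_sq_plane, PiLp.sub_apply, coordReflect_apply]
      simp
      ring
    have e2 : invDistSq x y * invDistSq x (coordReflect 0 (coordReflect 1 y)) =
        (‖x‖ ^ 2 * ‖y‖ ^ 2 + 1) ^ 2 - 4 * (x 0 * y 0 + x 1 * y 1) ^ 2 := by
      simp only [invDistSq, norm_sq_plane, coordReflect_apply]
      simp
      ring
    have hx2 : ‖x‖ ^ 2 ≤ ‖y‖ ^ 2 := by gcongr
    have hy2 : ‖y‖ ^ 2 ≤ 1 := pow_le_one₀ (norm_nonneg y) hy1
    have f1 : ‖x - coordReflect 0 y‖ ^ 2 * ‖x - coordReflect 1 y‖ ^ 2 ≤ 4 * ‖y‖ ^ 4 := by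
      rw [e1]
      nlinarith [sq_nonneg (x 0 * y 0 - x 1 * y 1), sq_nonneg ‖x‖, sq_nonneg ‖y‖]
    have f2 : invDistSq x y * invDistSq x (coordReflect 0 (coordReflect 1 y)) ≤ 4 := by
      rw [e2]
      have : ‖x‖ ^ 2 * ‖y‖ ^ 2 ≤ 1 :=
        mul_le_one₀ (hx2.trans hy2) (sq_nonneg _) hy2
      nlinarith [sq_nonneg (x 0 * y 0 + x 1 * y 1), mul_nonneg (sq_nonneg ‖x‖) (sq_nonneg ‖y‖)]
    calc _ ≤ 4 * ‖y‖ ^ 4 * 4 := mul_le_mul f1 f2 (by positivity) (by positivity)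
      _ = _ := by ring

/-- The kernel has the sign of the density when the density has the sign of `y₀ y₁ (1 - |y|)`. -/
lemma ae_mul_oddKernel_mul_nonpos {H : Plane → ℝ} {x : Plane} (hx : ‖x‖ ≤ 1)
    (hH : ∀ y, 0 ≤ y 0 * y 1 * (1 - ‖y‖) * H y) :
    ∀ᵐ y : Plane, x 0 * x 1 * (oddKernel x y * H y) ≤ 0 := by
  filter_upwards [ae_oddKernel_eq x] with y ⟨X, Y, hX, hY, hk, hd, _⟩
  rcases eq_or_ne X Y with rfl | hXY
  · simp [hk]
  have hmono : 0 ≤ (Y - X) * -oddKernel x y := by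
    rw [hk]
    rcases le_total X Y with h | h
    · have := Real.log_le_log hX h
      exact mul_nonneg (by linarith) (by linarith)
    · have := Real.log_le_log hY h
      exact mul_nonneg_of_nonpos_of_nonpos (by linarith) (by linarith)
  have hne : Y - X ≠ 0 := sub_ne_zero.2 hXY.symm
  set q := y 0 * y 1 * (1 - ‖y‖) with hq
  have hx0 := norm_nonneg x
  have hy0 := norm_nonneg y
  set m := 16 * (1 - ‖x‖ ^ 4) * ((1 + ‖y‖) * (1 + ‖y‖ ^ 2)) with hm
  -- The factor `1 - ‖y‖⁴` is split so that its sign-changing part `1 - ‖y‖` goes into `q`, leaving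
  -- `m ≥ 0`.
  have hd' : Y - X = x 0 * x 1 * q * m := by rw [hd, hq, hm]; ring
  rw [hd'] at hne hmono
  have hm0 : 0 < m := by
    have h1 : 0 ≤ m := by
      have : ‖x‖ ^ 4 ≤ 1 := pow_le_one₀ hx0 hx
      have : 0 ≤ 1 - ‖x‖ ^ 4 := by linarith
      positivity
    exact lt_of_le_of_ne h1 (Ne.symm (right_ne_zero_of_mul hne))
  have hq0 : q ≠ 0 := right_ne_zero_of_mul (left_ne_zero_of_mul hne)
  have hprod := mul_nonneg hmono (hH y)
  have he : x 0 * x 1 * q * m * -oddKernel x y * (q * H y) =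
      (m * q ^ 2) * (-(x 0 * x 1 * (oddKernel x y * H y))) := by ring
  rw [he] at hprod
  have := nonneg_of_mul_nonneg_right hprod (by positivity)
  linarith

/-- Maximum principle for the potential in the quadrants of the disc. -/
lemma mul_logPot_nonpos {C : ℝ} {H : Plane → ℝ} (hC : IsDecaying C H) (hO : IsKelvinOdd H)
    (hH : ∀ y, 0 ≤ y 0 * y 1 * (1 - ‖y‖) * H y) {x : Plane} (hx : ‖x‖ ≤ 1) :
    x 0 * x 1 * logPot H x ≤ 0 := by
  have h := (integral_oddKernel hC hO x).2
  have h1 : ∫ y, x 0 * x 1 * (oddKernel x y * H y) ≤ 0 :=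
    integral_nonpos_of_ae (ae_mul_oddKernel_mul_nonpos hx hH)
  rw [integral_const_mul, h] at h1
  linarith

/-- A lower bound for the kernel away from the origin. -/
lemma ae_le_neg_oddKernel {x : Plane} (hx : 0 ≤ x 0 * x 1) : ∀ᵐ y : Plane, ‖x‖ ≤ ‖y‖ →
    ‖y‖ ≤ 1 → 0 ≤ y 0 * y 1 →
      x 0 * x 1 * (y 0 * y 1) * (1 - ‖x‖ ^ 4) * (1 - ‖y‖ ^ 4) / (2 * ‖y‖ ^ 4) ≤
        -oddKernel x y := by
  filter_upwards [ae_oddKernel_eq x, ae_ne_plane 0] with y ⟨X, Y, hX, hY, hk, hd, hb⟩ hy0 hxy hy hyy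
  have hy' := norm_pos_iff.2 hy0
  have hY' := hb hxy hy
  -- This is `log s ≤ s - 1` at `s = X / Y`; with the difference `Y - X` known exactly, an upper
  -- bound for `Y` now suffices.
  have h1 : 1 - X / Y ≤ Real.log Y - Real.log X := by
    have := Real.log_le_sub_one_of_pos (div_pos hX hY)
    rw [Real.log_div hX.ne' hY.ne'] at this
    linarith
  set D := x 0 * x 1 * (y 0 * y 1) * (1 - ‖x‖ ^ 4) * (1 - ‖y‖ ^ 4) with hD
  have hD0 : 0 ≤ D := by
    have : ‖x‖ ^ 4 ≤ 1 := pow_le_one₀ (norm_nonneg x) (hxy.trans hy)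
    have : 0 ≤ 1 - ‖x‖ ^ 4 := by linarith
    have : ‖y‖ ^ 4 ≤ 1 := pow_le_one₀ (norm_nonneg y) hy
    have : 0 ≤ 1 - ‖y‖ ^ 4 := by linarith
    positivity
  have hd' : Y - X = 16 * D := by rw [hd, hD]; ring
  have h2 : 1 - X / Y = 16 * D / Y := by rw [← hd']; field_simp
  have h3 : 16 * D / (16 * ‖y‖ ^ 4) ≤ 16 * D / Y := by gcongr
  have h4 : D / (2 * ‖y‖ ^ 4) = 16 * D / (16 * ‖y‖ ^ 4) / 2 := by field_simp
  rw [h4, hk]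
  linarith

/-! ### The nonlinearity -/

/-- An odd nondecreasing function with logarithmic modulus of continuity at the origin. -/
noncomputable def nonlin (t : ℝ) : ℝ := Real.sign t * (1 + max 0 (-Real.log t))⁻¹

lemma nonlin_neg (t : ℝ) : nonlin (-t) = -nonlin t := by
  simp [nonlin, Real.sign_neg, Real.log_neg_eq_log]

lemma nonlin_zero : nonlin 0 = 0 := by simp [nonlin]

lemma nonlin_of_pos {t : ℝ} (ht : 0 < t) : nonlin t = (1 + max 0 (-Real.log t))⁻¹ := by
  rw [nonlin, Real.sign_of_pos ht, one_mul]

lemma nonlin_of_mem {t : ℝ} (ht : 0 < t) (ht1 : t ≤ 1) : nonlin t = (1 - Real.log t)⁻¹ := by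
  rw [nonlin_of_pos ht, max_eq_right (by linarith [Real.log_nonpos ht.le ht1]), sub_eq_add_neg]

lemma nonlin_mem {t : ℝ} (ht : 0 ≤ t) : nonlin t ∈ Icc (0 : ℝ) 1 := by
  rcases ht.eq_or_lt with rfl | ht
  · simp [nonlin_zero]
  rw [nonlin_of_pos ht]
  have : 0 ≤ max 0 (-Real.log t) := le_max_left _ _
  exact ⟨by positivity, inv_le_one_of_one_le₀ (by linarith)⟩

lemma abs_nonlin_le (t : ℝ) : |nonlin t| ≤ 1 := by
  rcases le_total 0 t with ht | ht
  · have := nonlin_mem ht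
    rw [abs_of_nonneg this.1]
    exact this.2
  · have := nonlin_mem (neg_nonneg.2 ht)
    rw [← abs_neg, ← nonlin_neg, abs_of_nonneg this.1]
    exact this.2

lemma monotone_nonlin : Monotone nonlin := by
  refine monotone_of_odd_of_monotoneOn_nonneg nonlin_neg fun s hs t ht hst => ?_
  rcases (show 0 ≤ s from hs).eq_or_lt with rfl | hs
  · rw [nonlin_zero]
    exact (nonlin_mem ht).1
  rw [nonlin_of_pos hs, nonlin_of_pos (hs.trans_le hst)]
  have h := Real.log_le_log hs hst
  have h0 : 0 ≤ max 0 (-Real.log t) := le_max_left _ _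
  gcongr

lemma continuousAt_nonlin_of_pos {t : ℝ} (ht : 0 < t) : ContinuousAt nonlin t := by
  have h : ContinuousAt (fun t : ℝ => (1 + max 0 (-Real.log t))⁻¹) t := by
    refine ContinuousAt.inv₀ ?_ ?_
    · have := Real.continuousAt_log ht.ne'
      fun_prop
    · have : 0 ≤ max 0 (-Real.log t) := le_max_left _ _
      positivity
  refine h.congr ?_
  filter_upwards [eventually_gt_nhds ht] with s hs
  rw [nonlin_of_pos hs]

lemma continuous_nonlin : Continuous nonlin := by
  rw [continuous_iff_continuousAt]
  intro t
  rcases lt_trichotomy t 0 with ht | rfl | ht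
  · have h : nonlin = fun s => -nonlin (-s) := by ext s; rw [nonlin_neg, neg_neg]
    rw [h]
    exact (ContinuousAt.comp (g := nonlin) (continuousAt_nonlin_of_pos (neg_pos.2 ht))
      continuous_neg.continuousAt).neg
  · rw [continuousAt_iff_punctured_nhds, nonlin_zero]
    refine squeeze_zero_norm' (a := fun t => (1 + -Real.log t)⁻¹) ?_ ?_
    · have hle : ∀ s : ℝ, 0 < s → s ≤ 1 → ‖nonlin s‖ ≤ (1 + -Real.log s)⁻¹ := fun s hs hs1 => by
        rw [Real.norm_of_nonneg (nonlin_mem hs.le).1, nonlin_of_mem hs hs1, sub_eq_add_neg]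
      have hnear : ∀ᶠ t : ℝ in 𝓝[≠] 0, t ∈ Ioo (-1 : ℝ) 1 :=
        mem_nhdsWithin_of_mem_nhds (Ioo_mem_nhds (by norm_num) (by norm_num))
      filter_upwards [hnear, self_mem_nhdsWithin] with t ht ht0
      rcases lt_or_gt_of_ne (show t ≠ 0 from ht0) with h | h
      · have := hle (-t) (by linarith) (by linarith [ht.1])
        rwa [nonlin_neg, norm_neg, Real.log_neg_eq_log] at this
      · exact hle t h ht.2.le
    · have := tendsto_neg_atBot_atTop.comp Real.tendsto_log_nhdsNE_zero
      exact (tendsto_atTop_add_const_left _ 1 this).inv_tendsto_atTop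
  · exact continuousAt_nonlin_of_pos ht

/-! ### Kelvin-odd extensions -/

/-- The extension of a function on the unit disc to a Kelvin-odd density on the plane. -/
noncomputable def kelvinExt (h : Plane → ℝ) (y : Plane) : ℝ :=
  (ball (0 : Plane) 1).indicator h y -
    ‖y‖⁻¹ ^ 4 * (ball (0 : Plane) 1).indicator h (circleInv y)

lemma kelvinExt_of_norm_lt {h : Plane → ℝ} {y : Plane} (hy : ‖y‖ < 1) : kelvinExt h y = h y := by
  rw [kelvinExt, indicator_of_mem (by simpa using hy)]
  rcases eq_or_ne y 0 with rfl | h0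
  · simp
  rw [indicator_of_notMem]
  · simp
  · rw [mem_ball_zero_iff, norm_circleInv, not_lt]
    exact (one_le_inv₀ (norm_pos_iff.2 h0)).2 hy.le

lemma kelvinExt_of_norm_eq {h : Plane → ℝ} {y : Plane} (hy : ‖y‖ = 1) : kelvinExt h y = 0 := by
  rw [kelvinExt, indicator_of_notMem, indicator_of_notMem]
  · simp
  · simp [norm_circleInv, hy]
  · simp [hy]

lemma kelvinExt_of_lt_norm {h : Plane → ℝ} {y : Plane} (hy : 1 < ‖y‖) :
    kelvinExt h y = -(‖y‖⁻¹ ^ 4 * h (circleInv y)) := by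
  rw [kelvinExt, indicator_of_notMem (by simpa using hy.le), indicator_of_mem, zero_sub]
  rw [mem_ball_zero_iff, norm_circleInv]
  exact inv_lt_one_of_one_lt₀ hy

lemma kelvinExt_sub (h₁ h₂ : Plane → ℝ) (y : Plane) :
    kelvinExt (fun z => h₁ z - h₂ z) y = kelvinExt h₁ y - kelvinExt h₂ y := by
  rcases lt_trichotomy ‖y‖ 1 with hy | hy | hy
  · simp only [kelvinExt_of_norm_lt hy]
  · simp only [kelvinExt_of_norm_eq hy, sub_zero]
  · simp only [kelvinExt_of_lt_norm hy]; ring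

lemma kelvinExt_congr {h₁ h₂ : Plane → ℝ} (h : EqOn h₁ h₂ (ball 0 1)) :
    kelvinExt h₁ = kelvinExt h₂ := by
  have : (ball (0 : Plane) 1).indicator h₁ = (ball (0 : Plane) 1).indicator h₂ := indicator_congr h
  ext y
  rw [kelvinExt, kelvinExt, this]

lemma measurable_kelvinExt {h : Plane → ℝ} (hh : Measurable h) : Measurable (kelvinExt h) := by
  have h1 := hh.indicator (measurableSet_ball (x := (0 : Plane)) (ε := 1))
  unfold kelvinExt
  exact h1.sub ((by fun_prop : Measurable fun y : Plane => ‖y‖⁻¹ ^ 4).mul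
    (h1.comp measurable_circleInv))

/-- The Jacobian weight supplies the fourth-power decay. The factor `16 = 2⁴` covers `1 + ‖y‖ ≤ 2`
inside the disc and `1 + ‖y‖ ≤ 2 ‖y‖` outside. -/
lemma isDecaying_kelvinExt {h : Plane → ℝ} {A : ℝ} (hh : Measurable h) (hA : ∀ y, |h y| ≤ A) :
    IsDecaying (16 * A) (kelvinExt h) := by
  refine ⟨measurable_kelvinExt hh, fun y => ?_⟩
  have hA0 : 0 ≤ A := (abs_nonneg _).trans (hA 0)
  have hy0 := norm_nonneg y
  have h4 : (1 + ‖y‖) ^ (-4 : ℝ) = ((1 + ‖y‖) ^ 4)⁻¹ := by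
    rw [Real.rpow_neg (by positivity)]; norm_cast
  rw [h4, ← div_eq_mul_inv, le_div_iff₀ (by positivity)]
  rcases lt_trichotomy ‖y‖ 1 with hy | hy | hy
  · rw [kelvinExt_of_norm_lt hy]
    have : (1 + ‖y‖) ^ 4 ≤ 2 ^ 4 := by gcongr; linarith
    nlinarith [hA y, abs_nonneg (h y)]
  · rw [kelvinExt_of_norm_eq hy]
    simpa using hA0
  · rw [kelvinExt_of_lt_norm hy, abs_neg, abs_mul, abs_of_nonneg (by positivity)]
    have h1 : ‖y‖⁻¹ * (1 + ‖y‖) ≤ 2 := by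
      rw [inv_mul_le_iff₀ (by linarith)]; linarith
    have h2 : (‖y‖⁻¹ * (1 + ‖y‖)) ^ 4 ≤ 2 ^ 4 := by gcongr
    calc ‖y‖⁻¹ ^ 4 * |h (circleInv y)| * (1 + ‖y‖) ^ 4
        = (‖y‖⁻¹ * (1 + ‖y‖)) ^ 4 * |h (circleInv y)| := by ring
      _ ≤ 2 ^ 4 * A := by gcongr; exact hA _
      _ = 16 * A := by norm_num

lemma isKelvinOdd_kelvinExt {h : Plane → ℝ} (hh : ∀ i y, h (coordReflect i y) = -h y) :
    IsKelvinOdd (kelvinExt h) := by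
  constructor
  · intro i y
    have h1 : ∀ z, (ball (0 : Plane) 1).indicator h (coordReflect i z) =
        -(ball (0 : Plane) 1).indicator h z := fun z => by
      by_cases hz : ‖z‖ < 1 <;> simp [indicator, hz, hh]
    rw [kelvinExt, kelvinExt, circleInv_coordReflect, h1, h1, LinearIsometryEquiv.norm_map]
    ring
  · intro y hy
    have := norm_ne_zero_iff.2 hy
    rw [kelvinExt, kelvinExt, circleInv_circleInv, norm_circleInv]
    field_simp
    ring

/-- Across the circle the factor `1 - ‖y‖` and the extension change sign together. -/
lemma mul_kelvinExt_nonneg {h : Plane → ℝ} (hh : ∀ y, ‖y‖ < 1 → 0 ≤ y 0 * y 1 * h y) (y : Plane) :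
    0 ≤ y 0 * y 1 * (1 - ‖y‖) * kelvinExt h y := by
  rcases lt_trichotomy ‖y‖ 1 with hy | hy | hy
  · rw [kelvinExt_of_norm_lt hy]
    nlinarith [mul_nonneg (hh y hy) (sub_nonneg.2 hy.le)]
  · rw [hy]; simp
  · rw [kelvinExt_of_lt_norm hy]
    have hc := hh (circleInv y) (by rw [norm_circleInv]; exact inv_lt_one_of_one_lt₀ hy)
    simp only [circleInv, PiLp.smul_apply, smul_eq_mul] at hc
    change 0 ≤ _ * h (circleInv y) at hc
    have he : y 0 * y 1 * (1 - ‖y‖) * -(‖y‖⁻¹ ^ 4 * h (circleInv y)) =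
        (‖y‖ - 1) * ((‖y‖ ^ 2)⁻¹ * y 0 * ((‖y‖ ^ 2)⁻¹ * y 1) * h (circleInv y)) := by
      field_simp
      ring
    rw [he]
    exact mul_nonneg (by linarith) hc

/-! ### Monotone iteration -/

/-- The harmonic boundary datum. -/
noncomputable def coordProd (x : Plane) : ℝ := x 0 * x 1

/-- One step of the monotone iteration: the solution of `Δ v = -nonlin u` with boundary values
`x₀ x₁`. -/
noncomputable def poissonStep (u : Plane → ℝ) (x : Plane) : ℝ :=
  coordProd x - logMass⁻¹ * logPot (kelvinExt (fun y => nonlin (u y))) x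

lemma contDiff_coordProd {n : WithTop ℕ∞} : ContDiff ℝ n coordProd := by
  unfold coordProd; fun_prop

lemma abs_coordProd_le {x : Plane} (hx : ‖x‖ ≤ 1) : |coordProd x| ≤ 1 := by
  have h := norm_sq_plane x
  have : ‖x‖ ^ 2 ≤ 1 := pow_le_one₀ (norm_nonneg x) hx
  rw [coordProd, abs_le]
  constructor <;> nlinarith [sq_nonneg (x 0 - x 1), sq_nonneg (x 0 + x 1)]

lemma coordProd_coordReflect (i : Fin 2) (x : Plane) :
    coordProd (coordReflect i x) = -coordProd x := by
  fin_cases i <;> simp [coordProd, coordReflect_apply]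

/-- Measurable functions that are odd in each coordinate. -/
structure IsMeasurableOdd (u : Plane → ℝ) : Prop where
  measurable : Measurable u
  reflect : ∀ i y, u (coordReflect i y) = -u y

namespace IsMeasurableOdd

variable {u v : Plane → ℝ}

/-- The constant does not depend on `u`, since `nonlin` is bounded by `1`; the bounds along the
iteration are therefore uniform. -/
lemma isDecaying (hu : IsMeasurableOdd u) :
    IsDecaying (16 * 1) (kelvinExt (fun y => nonlin (u y))) :=
  isDecaying_kelvinExt (continuous_nonlin.measurable.comp hu.measurable) fun _ => abs_nonlin_le _

lemma isKelvinOdd (hu : IsMeasurableOdd u) : IsKelvinOdd (kelvinExt (fun y => nonlin (u y))) :=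
  isKelvinOdd_kelvinExt fun i y => by rw [hu.reflect, nonlin_neg]

lemma contDiff_poissonStep (hu : IsMeasurableOdd u) : ContDiff ℝ 1 (poissonStep u) :=
  contDiff_coordProd.sub (contDiff_const.mul hu.isDecaying.contDiff_logPot)

lemma poissonStep (hu : IsMeasurableOdd u) : IsMeasurableOdd (poissonStep u) := by
  refine ⟨hu.contDiff_poissonStep.continuous.measurable, fun i y => ?_⟩
  rw [_root_.poissonStep, _root_.poissonStep, coordProd_coordReflect,
    logPot_coordReflect hu.isDecaying hu.isKelvinOdd]
  ring

lemma abs_poissonStep_le (hu : IsMeasurableOdd u) {x : Plane} (hx : ‖x‖ ≤ 1) :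
    |_root_.poissonStep u x| ≤ 1 + logMass⁻¹ *
      (16 * 1 * ((∫ y, singPart y) + 3 * ∫ y : Plane, (1 + ‖y‖) ^ (-3 : ℝ))) := by
  refine (abs_sub _ _).trans (add_le_add (abs_coordProd_le hx) ?_)
  rw [abs_mul, abs_of_pos (inv_pos.2 logMass_pos)]
  exact mul_le_mul_of_nonneg_left (hu.isDecaying.abs_logPot_le_of_mem hx)
    (inv_pos.2 logMass_pos).le

/-- Comparison principle for the order "larger in the quadrants where `coordProd > 0`, smaller in
the others": monotonicity of `nonlin` gives the difference of densities the sign required by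
`mul_logPot_nonpos`. -/
lemma mul_poissonStep_sub_nonneg (hu : IsMeasurableOdd u) (hv : IsMeasurableOdd v)
    (huv : ∀ y, ‖y‖ ≤ 1 → 0 ≤ coordProd y * (v y - u y)) {x : Plane} (hx : ‖x‖ ≤ 1) :
    0 ≤ coordProd x * (_root_.poissonStep v x - _root_.poissonStep u x) := by
  set h : Plane → ℝ := fun y => nonlin (v y) - nonlin (u y) with hh
  have hm : Measurable h := (continuous_nonlin.measurable.comp hv.measurable).sub
    (continuous_nonlin.measurable.comp hu.measurable)
  have hb : ∀ y, |h y| ≤ 2 := fun y =>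
    (abs_sub _ _).trans (by linarith [abs_nonlin_le (v y), abs_nonlin_le (u y)])
  have ho : ∀ i y, h (coordReflect i y) = -h y := fun i y => by
    simp only [hh, hu.reflect, hv.reflect, nonlin_neg]; ring
  have hs : ∀ y, ‖y‖ < 1 → 0 ≤ y 0 * y 1 * h y := fun y hy => by
    have h1 := huv y hy.le
    rw [coordProd] at h1
    rcases lt_trichotomy (y 0 * y 1) 0 with h0 | h0 | h0
    · have h2 : v y ≤ u y := by nlinarith
      have := monotone_nonlin h2
      exact mul_nonneg_of_nonpos_of_nonpos h0.le (by simp only [hh]; linarith)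
    · rw [h0]; simp
    · have h2 : u y ≤ v y := by nlinarith
      have := monotone_nonlin h2
      exact mul_nonneg h0.le (by simp only [hh]; linarith)
  have key := mul_logPot_nonpos (isDecaying_kelvinExt hm hb) (isKelvinOdd_kelvinExt ho)
    (mul_kelvinExt_nonneg hs) hx
  have hlin : logPot (kelvinExt h) x = logPot (kelvinExt fun y => nonlin (v y)) x -
      logPot (kelvinExt fun y => nonlin (u y)) x := by
    simp only [logPot, hh, kelvinExt_sub, mul_sub]
    exact integral_sub (hv.isDecaying.integrable_log_mul x) (hu.isDecaying.integrable_log_mul x)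
  rw [hlin] at key
  simp only [_root_.poissonStep, coordProd]
  have := mul_nonneg (inv_pos.2 logMass_pos).le (neg_nonneg.2 key)
  linarith

end IsMeasurableOdd

/-- The monotone iteration. -/
noncomputable def poissonIter (n : ℕ) : Plane → ℝ := poissonStep^[n] coordProd

lemma poissonIter_succ (n : ℕ) : poissonIter (n + 1) = poissonStep (poissonIter n) :=
  Function.iterate_succ_apply' _ _ _

lemma isMeasurableOdd_poissonIter (n : ℕ) : IsMeasurableOdd (poissonIter n) := by
  induction n with
  | zero => exact ⟨(contDiff_coordProd (n := 0)).continuous.measurable, coordProd_coordReflect⟩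
  | succ n ih => rw [poissonIter_succ]; exact ih.poissonStep

/-- The step applied to `0` returns `coordProd`, so this is comparison of `u` with `0`. -/
lemma mul_poissonStep_sub_coordProd_nonneg {u : Plane → ℝ} (hu : IsMeasurableOdd u)
    (hs : ∀ y, ‖y‖ ≤ 1 → 0 ≤ coordProd y * (u y - coordProd y)) {x : Plane} (hx : ‖x‖ ≤ 1) :
    0 ≤ coordProd x * (poissonStep u x - coordProd x) := by
  have h0 : IsMeasurableOdd (fun _ : Plane => (0 : ℝ)) := ⟨measurable_const, by simp⟩
  have h := h0.mul_poissonStep_sub_nonneg hu (fun y hy => by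
    rw [sub_zero]
    linarith [hs y hy, mul_self_nonneg (coordProd y)]) hx
  have hz : poissonStep (fun _ => 0) x = coordProd x := by
    have : kelvinExt (fun _ : Plane => (0 : ℝ)) = fun _ => 0 := by
      ext y; simp [kelvinExt]
    simp [poissonStep, nonlin_zero, this, logPot]
  rwa [hz] at h

lemma mul_poissonIter_sub_nonneg (n : ℕ) {x : Plane} (hx : ‖x‖ ≤ 1) :
    0 ≤ coordProd x * (poissonIter n x - coordProd x) := by
  induction n generalizing x with
  | zero => simp [poissonIter]
  | succ n ih =>
    rw [poissonIter_succ]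
    exact mul_poissonStep_sub_coordProd_nonneg (isMeasurableOdd_poissonIter n) (fun y hy => ih hy) hx

lemma mul_poissonIter_succ_sub_nonneg (n : ℕ) {x : Plane} (hx : ‖x‖ ≤ 1) :
    0 ≤ coordProd x * (poissonIter (n + 1) x - poissonIter n x) := by
  induction n generalizing x with
  | zero => exact mul_poissonIter_sub_nonneg 1 hx
  | succ n ih =>
    rw [poissonIter_succ (n + 1), poissonIter_succ n]
    refine (isMeasurableOdd_poissonIter n).mul_poissonStep_sub_nonneg ?_ (fun y hy => ?_) hx
    · rw [← poissonIter_succ]; exact isMeasurableOdd_poissonIter (n + 1)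
    · rw [← poissonIter_succ]; exact ih hy

lemma exists_abs_poissonIter_le : ∃ M, ∀ n x, ‖x‖ ≤ 1 → |poissonIter n x| ≤ M := by
  refine ⟨1 + logMass⁻¹ *
    (16 * 1 * ((∫ y, singPart y) + 3 * ∫ y : Plane, (1 + ‖y‖) ^ (-3 : ℝ))), fun n x hx => ?_⟩
  cases n with
  | zero =>
    refine (abs_coordProd_le hx).trans (le_add_of_nonneg_right ?_)
    have h1 : 0 ≤ ∫ y : Plane, (1 + ‖y‖) ^ (-3 : ℝ) := integral_nonneg fun y => by positivity
    have h2 : 0 ≤ ∫ y, singPart y := integral_nonneg singPart_nonneg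
    have := logMass_pos
    positivity
  | succ n =>
    rw [poissonIter_succ]
    exact (isMeasurableOdd_poissonIter n).abs_poissonStep_le hx

/-- Each point of an axis is fixed by a reflection. This covers the points at which the order
weighted by `coordProd` carries no information. -/
lemma eq_zero_of_coordProd_eq_zero {u : Plane → ℝ} (hu : IsMeasurableOdd u) {x : Plane}
    (hx : coordProd x = 0) : u x = 0 := by
  rcases mul_eq_zero.1 hx with h | h
  · have h1 := hu.reflect 0 x
    rw [show coordReflect 0 x = x by ext j; fin_cases j <;> simp [coordReflect_apply, h]] at h1
    linarith
  · have h1 := hu.reflect 1 x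
    rw [show coordReflect 1 x = x by ext j; fin_cases j <;> simp [coordReflect_apply, h]] at h1
    linarith

lemma exists_tendsto_poissonIter {x : Plane} (hx : ‖x‖ ≤ 1) :
    ∃ l, Tendsto (fun n => poissonIter n x) atTop (𝓝 l) := by
  rcases eq_or_ne (coordProd x) 0 with h0 | h0
  · refine ⟨0, ?_⟩
    simp only [fun n => eq_zero_of_coordProd_eq_zero (isMeasurableOdd_poissonIter n) h0]
    exact tendsto_const_nhds
  obtain ⟨M, hM⟩ := exists_abs_poissonIter_le
  have hmono : Monotone fun n => coordProd x * poissonIter n x :=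
    monotone_nat_of_le_succ fun n => by linarith [mul_poissonIter_succ_sub_nonneg n hx]
  have hbdd : BddAbove (range fun n => coordProd x * poissonIter n x) := by
    refine ⟨|coordProd x| * M, ?_⟩
    rintro _ ⟨n, rfl⟩
    refine (le_abs_self _).trans ?_
    rw [abs_mul]
    exact mul_le_mul_of_nonneg_left (hM n x hx) (abs_nonneg _)
  have h := (tendsto_atTop_ciSup hmono hbdd).const_mul (coordProd x)⁻¹
  simp only [inv_mul_cancel_left₀ h0] at h
  exact ⟨_, h⟩

/-- Existence of a solution of the semilinear problem, as a fixed point of `poissonStep`. -/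
theorem exists_poissonStep_fixed : ∃ u : Plane → ℝ, IsMeasurableOdd u ∧ u = poissonStep u ∧
    ∀ x, ‖x‖ ≤ 1 → 0 ≤ coordProd x * (u x - coordProd x) := by
  -- The iterates are controlled only on the closed disc; truncation gives a limit that is defined
  -- and measurable everywhere.
  have hex : ∀ x, ∃ l, Tendsto (fun n => (closedBall (0 : Plane) 1).indicator (poissonIter n) x)
      atTop (𝓝 l) := fun x => by
    by_cases hx : ‖x‖ ≤ 1
    · simpa [indicator, hx] using exists_tendsto_poissonIter hx
    · exact ⟨0, by simp [indicator, hx]⟩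
  choose U hU using hex
  have hUmeas : Measurable U := measurable_of_tendsto_metrizable
    (fun n => (isMeasurableOdd_poissonIter n).measurable.indicator measurableSet_closedBall)
    (tendsto_pi_nhds.2 hU)
  have hUin : ∀ x, ‖x‖ ≤ 1 → Tendsto (fun n => poissonIter n x) atTop (𝓝 (U x)) := fun x hx => by
    simpa [indicator, hx] using hU x
  have hUodd : IsMeasurableOdd U := by
    refine ⟨hUmeas, fun i y => tendsto_nhds_unique (hU _) ((hU y).neg.congr fun n => ?_)⟩
    by_cases hy : ‖y‖ ≤ 1 <;>
      simp [indicator, hy, (isMeasurableOdd_poissonIter n).reflect]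
  have hconv : ∀ x, Tendsto (fun n => poissonIter (n + 1) x) atTop (𝓝 (poissonStep U x)) := by
    intro x
    simp only [poissonIter_succ, poissonStep]
    refine tendsto_const_nhds.sub (Tendsto.const_mul _ ?_)
    refine tendsto_integral_of_dominated_convergence (logMajorant (16 * 1) x)
      (fun n => ((isMeasurableOdd_poissonIter n).isDecaying.integrable_log_mul x).aestronglyMeasurable)
      (integrable_logMajorant _ x)
      (fun n => .of_forall fun y => (isMeasurableOdd_poissonIter n).isDecaying.log_mul_le x y)
      (.of_forall fun y => Tendsto.const_mul _ ?_)
    have hin : ∀ z, ‖z‖ ≤ 1 → Tendsto (fun n => nonlin (poissonIter n z)) atTop (𝓝 (nonlin (U z))) :=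
      fun z hz => (continuous_nonlin.tendsto _).comp (hUin z hz)
    rcases lt_trichotomy ‖y‖ 1 with hy | hy | hy
    · simp only [kelvinExt_of_norm_lt hy]
      exact hin y hy.le
    · simp only [kelvinExt_of_norm_eq hy]
      exact tendsto_const_nhds
    · simp only [kelvinExt_of_lt_norm hy]
      refine ((hin _ ?_).const_mul _).neg
      rw [norm_circleInv]
      exact inv_le_one_of_one_le₀ hy.le
  have hfix : ∀ x, ‖x‖ ≤ 1 → U x = poissonStep U x := fun x hx =>
    tendsto_nhds_unique ((hUin x hx).comp (tendsto_add_atTop_nat 1)) (hconv x)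
  -- `U` is zero outside the disc and satisfies the equation only on it. Since `kelvinExt` sees only
  -- values in the open disc, `poissonStep U` is a fixed point on the whole plane.
  refine ⟨poissonStep U, hUodd.poissonStep, ?_, fun x hx => ?_⟩
  · have : kelvinExt (fun y => nonlin (U y)) = kelvinExt (fun y => nonlin (poissonStep U y)) :=
      kelvinExt_congr fun y hy => by
        rw [← hfix y (mem_ball_zero_iff.1 hy).le]
    ext x
    conv_lhs => rw [poissonStep, this]
    rfl
  · rw [← hfix x hx]
    exact ge_of_tendsto' (((hUin x hx).sub_const _).const_mul _)
      fun n => mul_poissonIter_sub_nonneg n hx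

/-! ### Logarithmic growth at the origin -/

/-- The square `(q/2, q]²`. -/
def dyadicBox (q : ℝ) : Set Plane := {y | ∀ i, y i ∈ Ioc (q / 2) q}

lemma dyadicBox_eq (q : ℝ) :
    dyadicBox q = (WithLp.ofLp : Plane → Fin 2 → ℝ) ⁻¹' univ.pi fun _ => Ioc (q / 2) q := by
  ext y; simp [dyadicBox]

lemma measurableSet_dyadicBox (q : ℝ) : MeasurableSet (dyadicBox q) := by
  rw [dyadicBox_eq]
  exact (PiLp.volume_preserving_ofLp (Fin 2)).measurable
    (MeasurableSet.univ_pi fun _ => measurableSet_Ioc)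

lemma volume_dyadicBox {q : ℝ} (hq : 0 ≤ q) : volume (dyadicBox q) = ENNReal.ofReal (q ^ 2 / 4) := by
  rw [dyadicBox_eq, (PiLp.volume_preserving_ofLp (Fin 2)).measure_preimage
    (MeasurableSet.univ_pi fun _ => measurableSet_Ioc).nullMeasurableSet, Real.volume_pi_Ioc,
    Fin.prod_univ_two, ← ENNReal.ofReal_mul (by linarith)]
  congr 1
  ring

lemma disjoint_dyadicBox {q r : ℝ} (h : q ≤ r / 2) : Disjoint (dyadicBox q) (dyadicBox r) :=
  Set.disjoint_left.2 fun y hy hy' => by linarith [(hy 0).2, (hy' 0).1]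

/-- The point `(t, t)`. -/
noncomputable def diagPt (t : ℝ) : Plane := !₂[t, t]

lemma norm_diagPt_sq (t : ℝ) : ‖diagPt t‖ ^ 2 = 2 * t ^ 2 := by
  rw [norm_sq_plane]; simp [diagPt]; ring

/-- The argument is the lower bound for `y₀ y₁` on the box of side parameter `q = 2⁻⁽ʲ⁺¹⁾`; there `1
- log` is at most `1 + 2 (j + 2) ≤ 5 (j + 1)`. -/
lemma inv_le_nonlin (j : ℕ) : 1 / (5 * ((j : ℝ) + 1)) ≤ nonlin (((1 / 2) ^ (j + 2)) ^ 2) := by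
  have hq : (0 : ℝ) < ((1 / 2) ^ (j + 2)) ^ 2 := by positivity
  have hq1 : ((1 / 2 : ℝ) ^ (j + 2)) ^ 2 ≤ 1 :=
    pow_le_one₀ (by positivity) (pow_le_one₀ (by norm_num) (by norm_num))
  rw [nonlin_of_mem hq hq1, one_div]
  have hl : Real.log (((1 / 2 : ℝ) ^ (j + 2)) ^ 2) = -(2 * ((j : ℝ) + 2) * Real.log 2) := by
    rw [Real.log_pow, Real.log_pow, one_div, Real.log_inv]; push_cast; ring
  have h2 : Real.log 2 ≤ 1 := by linarith [Real.log_two_lt_d9]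
  have h2' : 0 ≤ Real.log 2 := Real.log_nonneg (by norm_num)
  have hj : (0 : ℝ) ≤ j := j.cast_nonneg
  rw [hl, sub_neg_eq_add]
  refine inv_anti₀ (by positivity) ?_
  nlinarith

lemma ae_le_integrand {u : Plane → ℝ}
    (hu : ∀ x, ‖x‖ ≤ 1 → 0 ≤ coordProd x * (u x - coordProd x)) {t : ℝ} (ht : 0 < t) (j : ℕ)
    (htj : t ≤ (1 / 2) ^ (j + 2)) :
    ∀ᵐ y : Plane, y ∈ dyadicBox ((1 / 2) ^ (j + 1)) →
      t ^ 2 / (500 * ((1 / 2) ^ (j + 1)) ^ 2 * ((j : ℝ) + 1)) ≤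
        -(oddKernel (diagPt t) y * kelvinExt (fun y => nonlin (u y)) y) := by
  have hx0 : diagPt t 0 = t := by simp [diagPt]
  have hx1 : diagPt t 1 = t := by simp [diagPt]
  filter_upwards [ae_le_neg_oddKernel (x := diagPt t) (by rw [hx0, hx1]; positivity)] with y hk hy
  have hnl := inv_le_nonlin j
  set q : ℝ := (1 / 2) ^ (j + 1) with hq
  have hq0 : 0 < q := by positivity
  have hq2 : q ≤ 1 / 2 := by
    rw [hq, pow_succ]
    have : (1 / 2 : ℝ) ^ j ≤ 1 := pow_le_one₀ (by norm_num) (by norm_num)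
    linarith
  have hqs : (1 / 2 : ℝ) ^ (j + 2) = q / 2 := by rw [hq]; ring
  rw [hqs] at htj hnl
  obtain ⟨a0, a1⟩ := hy 0
  obtain ⟨b0, b1⟩ := hy 1
  have hy0 : 0 < y 0 := by linarith
  have hy1 : 0 < y 1 := by linarith
  have hprod : (q / 2) ^ 2 ≤ y 0 * y 1 := by
    rw [sq]; exact mul_le_mul a0.le b0.le (by positivity) hy0.le
  have hn := norm_sq_plane y
  have hn1 : ‖y‖ ^ 2 ≤ 2 * q ^ 2 := by rw [hn]; nlinarith
  have hn4 : ‖y‖ ^ 4 ≤ 4 * q ^ 4 := by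
    have : (‖y‖ ^ 2) ^ 2 ≤ (2 * q ^ 2) ^ 2 := by gcongr
    linarith
  have hq4 : q ^ 4 ≤ 1 / 16 := by
    have : q ^ 4 ≤ (1 / 2) ^ 4 := by gcongr
    linarith
  have hn0 : 0 < ‖y‖ ^ 2 := by rw [hn]; positivity
  have hnpos : 0 < ‖y‖ := by
    rcases (norm_nonneg y).eq_or_lt with h | h
    · rw [← h] at hn0; norm_num at hn0
    · exact h
  have hny : ‖y‖ < 1 := by
    have : ‖y‖ ^ 2 < 1 := by nlinarith
    exact (sq_lt_one_iff₀ hnpos.le).1 this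
  have hxy2 : ‖diagPt t‖ ^ 2 ≤ ‖y‖ ^ 2 := by
    rw [norm_diagPt_sq, hn]; nlinarith
  have hxy : ‖diagPt t‖ ≤ ‖y‖ := (sq_le_sq₀ (norm_nonneg _) hnpos.le).1 hxy2
  have hx4 : ‖diagPt t‖ ^ 4 ≤ ‖y‖ ^ 4 := by gcongr
  have hk' := hk hxy hny.le (by positivity)
  rw [hx0, hx1] at hk'
  have huy : y 0 * y 1 ≤ u y := by
    have h1 := hu y hny.le
    rw [coordProd] at h1
    have h2 := nonneg_of_mul_nonneg_right h1 (by positivity)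
    linarith
  have hnl' : 1 / (5 * ((j : ℝ) + 1)) ≤ nonlin (u y) :=
    hnl.trans (monotone_nonlin (hprod.trans huy))
  rw [kelvinExt_of_norm_lt hny, ← neg_mul]
  have hker : t ^ 2 / (100 * q ^ 2) ≤ -oddKernel (diagPt t) y := by
    refine le_trans ?_ hk'
    rw [div_le_div_iff₀ (by positivity) (by positivity)]
    have h1 : (3 / 4 : ℝ) ≤ 1 - ‖diagPt t‖ ^ 4 := by linarith
    have h2 : (3 / 4 : ℝ) ≤ 1 - ‖y‖ ^ 4 := by linarith
    have h3 : (q / 2) ^ 2 * (3 / 4) * (3 / 4) ≤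
        y 0 * y 1 * (1 - ‖diagPt t‖ ^ 4) * (1 - ‖y‖ ^ 4) := by gcongr
    -- In units of `q⁴` this reads `8 ≤ 100 · 9 / 64`, using `‖y‖⁴ ≤ 4 q⁴`; each `3 / 4` is `1 - 4 /
    -- 16`.
    have h5 : 2 * ‖y‖ ^ 4 ≤ ((q / 2) ^ 2 * (3 / 4) * (3 / 4)) * (100 * q ^ 2) := by
      have : 0 ≤ q ^ 4 := by positivity
      linarith
    calc t ^ 2 * (2 * ‖y‖ ^ 4)
        ≤ t ^ 2 * (((q / 2) ^ 2 * (3 / 4) * (3 / 4)) * (100 * q ^ 2)) := by gcongr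
      _ ≤ t ^ 2 * ((y 0 * y 1 * (1 - ‖diagPt t‖ ^ 4) * (1 - ‖y‖ ^ 4)) * (100 * q ^ 2)) := by gcongr
      _ = _ := by ring
  calc t ^ 2 / (500 * q ^ 2 * ((j : ℝ) + 1))
      = t ^ 2 / (100 * q ^ 2) * (1 / (5 * ((j : ℝ) + 1))) := by field_simp; norm_num
    _ ≤ _ := mul_le_mul hker hnl' (by positivity) (le_trans (by positivity) hker)

/-- A box of area `q² / 4` cancels the `q²` of `ae_le_integrand`, so scale `j` contributes `t² /
(2000 (j + 1))`. The boxes are disjoint, the integrand is nonnegative elsewhere, and the `8` of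
`integral_oddKernel` turns `2000` into `16000`. -/
lemma sum_le_neg_logPot {u : Plane → ℝ} (hu : IsMeasurableOdd u)
    (hup : ∀ x, ‖x‖ ≤ 1 → 0 ≤ coordProd x * (u x - coordProd x)) (n : ℕ) :
    ((1 / 2 : ℝ) ^ (n + 1)) ^ 2 / 16000 * ∑ j ∈ Finset.range n, 1 / ((j : ℝ) + 1) ≤
      -logPot (kelvinExt fun y => nonlin (u y)) (diagPt ((1 / 2) ^ (n + 1))) := by
  set t : ℝ := (1 / 2) ^ (n + 1) with ht
  have ht0 : 0 < t := by positivity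
  have ht2 : t ≤ 1 / 2 := by
    rw [ht, pow_succ]
    have : (1 / 2 : ℝ) ^ n ≤ 1 := pow_le_one₀ (by norm_num) (by norm_num)
    linarith
  set K := kelvinExt fun y => nonlin (u y) with hK
  have hx0 : diagPt t 0 = t := by simp [diagPt]
  have hx1 : diagPt t 1 = t := by simp [diagPt]
  have hx : ‖diagPt t‖ ≤ 1 := by
    have : ‖diagPt t‖ ^ 2 ≤ 1 := by rw [norm_diagPt_sq]; nlinarith
    exact (sq_le_one_iff₀ (norm_nonneg _)).1 this
  obtain ⟨hint, hval⟩ := integral_oddKernel hu.isDecaying hu.isKelvinOdd (diagPt t)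
  have hsign : ∀ y : Plane, ‖y‖ < 1 → 0 ≤ y 0 * y 1 * nonlin (u y) := fun y hy => by
    have h1 := hup y hy.le
    rw [coordProd] at h1
    rcases lt_trichotomy (y 0 * y 1) 0 with h0 | h0 | h0
    · have h2 : u y ≤ 0 := by nlinarith
      have := monotone_nonlin h2
      rw [nonlin_zero] at this
      exact mul_nonneg_of_nonpos_of_nonpos h0.le this
    · rw [h0]; simp
    · have h2 : 0 ≤ u y := by nlinarith
      exact mul_nonneg h0.le (nonlin_mem h2).1
  have hnn : 0 ≤ᵐ[volume] fun y => -(oddKernel (diagPt t) y * K y) := by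
    filter_upwards [ae_mul_oddKernel_mul_nonpos hx (mul_kelvinExt_nonneg hsign)] with y hy
    rw [hx0, hx1] at hy
    have : 0 ≤ t * t * -(oddKernel (diagPt t) y * K y) := by linarith
    exact nonneg_of_mul_nonneg_right this (by positivity)
  have hdisj : Pairwise (Function.onFun Disjoint fun j : ℕ => dyadicBox ((1 / 2) ^ (j + 1))) := by
    have hlt : ∀ i j : ℕ, i < j → ((1 / 2 : ℝ) ^ (j + 1)) ≤ (1 / 2) ^ (i + 1) / 2 := fun i j hij => by
      have : (1 / 2 : ℝ) ^ (j + 1) ≤ (1 / 2) ^ (i + 2) :=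
        pow_le_pow_of_le_one (by norm_num) (by norm_num) (by lia)
      rw [pow_succ _ (i + 1)] at this
      linarith
    intro i j hij
    rcases lt_or_gt_of_ne hij with h | h
    · exact (disjoint_dyadicBox (hlt i j h)).symm
    · exact disjoint_dyadicBox (hlt j i h)
  have hbox : ∀ j ∈ Finset.range n, t ^ 2 / 2000 * (1 / ((j : ℝ) + 1)) ≤
      ∫ y in dyadicBox ((1 / 2) ^ (j + 1)), -(oddKernel (diagPt t) y * K y) := by
    intro j hj
    have hjn : j < n := Finset.mem_range.1 hj
    have hle := ae_le_integrand hup ht0 j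
      (pow_le_pow_of_le_one (by norm_num) (by norm_num) (by lia))
    have hv := volume_dyadicBox (q := (1 / 2) ^ (j + 1)) (by positivity)
    calc t ^ 2 / 2000 * (1 / ((j : ℝ) + 1))
        = ∫ y in dyadicBox ((1 / 2) ^ (j + 1)),
            t ^ 2 / (500 * ((1 / 2) ^ (j + 1)) ^ 2 * ((j : ℝ) + 1)) := by
          rw [setIntegral_const, measureReal_def, hv, ENNReal.toReal_ofReal (by positivity),
            smul_eq_mul]
          field_simp
          norm_num
      _ ≤ _ := by
          refine setIntegral_mono_on_ae ?_ hint.neg.integrableOn (measurableSet_dyadicBox _) hle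
          exact integrableOn_const (by rw [hv]; exact ENNReal.ofReal_ne_top)
  have h1 : ∑ j ∈ Finset.range n, t ^ 2 / 2000 * (1 / ((j : ℝ) + 1)) ≤
      ∫ y, -(oddKernel (diagPt t) y * K y) :=
    calc _ ≤ ∑ j ∈ Finset.range n, _ := Finset.sum_le_sum hbox
      _ = ∫ y in ⋃ j ∈ Finset.range n, dyadicBox ((1 / 2) ^ (j + 1)),
            -(oddKernel (diagPt t) y * K y) :=
          (integral_biUnion_finset _ (fun j _ => measurableSet_dyadicBox _)
            (fun i _ j _ hij => hdisj hij) fun j _ => hint.neg.integrableOn).symm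
      _ ≤ _ := setIntegral_le_integral hint.neg hnn
  rw [integral_neg, hval, ← Finset.mul_sum] at h1
  linarith

lemma tendsto_div_norm_sq {u : Plane → ℝ} (hu : IsMeasurableOdd u) (hfix : u = poissonStep u)
    (hup : ∀ x, ‖x‖ ≤ 1 → 0 ≤ coordProd x * (u x - coordProd x)) :
    Tendsto (fun n : ℕ => u (diagPt ((1 / 2) ^ (n + 1))) / ‖diagPt ((1 / 2) ^ (n + 1))‖ ^ 2)
      atTop atTop := by
  have hc := inv_pos.2 logMass_pos
  -- The constant doubles to `32000` because `‖(t, t)‖² = 2 t²`.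
  refine tendsto_atTop_mono (fun n => ?_)
    (Real.tendsto_sum_range_one_div_nat_succ_atTop.const_mul_atTop
      (show 0 < logMass⁻¹ / 32000 by positivity))
  have h := sum_le_neg_logPot hu hup n
  set t : ℝ := (1 / 2) ^ (n + 1) with ht
  have ht0 : 0 < t := by positivity
  rw [norm_diagPt_sq, le_div_iff₀ (by positivity)]
  have hval : u (diagPt t) = t * t - logMass⁻¹ *
      logPot (kelvinExt fun y => nonlin (u y)) (diagPt t) := by
    conv_lhs => rw [hfix]
    simp [poissonStep, coordProd, diagPt]
  have := mul_le_mul_of_nonneg_left h hc.le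
  rw [hval]
  nlinarith [mul_pos ht0 ht0]

lemma tendsto_diagPt : Tendsto (fun n : ℕ => diagPt ((1 / 2) ^ (n + 1))) atTop (𝓝 0) := by
  have hc : Continuous diagPt := by unfold diagPt; fun_prop
  have h0 : diagPt 0 = 0 := by ext i; fin_cases i <;> simp [diagPt]
  have h1 : Tendsto (fun n : ℕ => ((1 : ℝ) / 2) ^ (n + 1)) atTop (𝓝 0) :=
    (tendsto_pow_atTop_nhds_zero_of_lt_one (by norm_num) (by norm_num)).comp
      (tendsto_add_atTop_nat 1)
  have := (hc.tendsto 0).comp h1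
  rwa [h0] at this

/-- Functions of class `C²` with vanishing value and gradient are quadratically bounded. -/
lemma exists_eventually_abs_le_of_contDiffAt {E : Type*} [NormedAddCommGroup E] [NormedSpace ℝ E]
    {u : E → ℝ} (hu : ContDiffAt ℝ 2 u 0) (h0 : u 0 = 0) (h1 : fderiv ℝ u 0 = 0) :
    ∃ C, ∀ᶠ x in 𝓝 (0 : E), |u x| ≤ C * ‖x‖ ^ 2 := by
  have hd : DifferentiableAt ℝ (fderiv ℝ u) 0 :=
    (hu.fderiv_right (m := 1) (by norm_num)).differentiableAt (by norm_num)
  obtain ⟨C, hC⟩ := hd.hasFDerivAt.isBigO_sub.bound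
  simp only [h1, sub_zero] at hC
  have hdiff : ∀ᶠ x in 𝓝 (0 : E), DifferentiableAt ℝ u x := by
    filter_upwards [hu.eventually (by simp)] with x hx using hx.differentiableAt (by norm_num)
  obtain ⟨δ, hδ, hb⟩ := Metric.eventually_nhds_iff_ball.1 (hC.and hdiff)
  refine ⟨max C 0, ?_⟩
  filter_upwards [ball_mem_nhds (0 : E) hδ] with x hx
  have hsub : ∀ z ∈ closedBall (0 : E) ‖x‖, z ∈ ball (0 : E) δ := fun z hz =>
    mem_ball_zero_iff.2 ((mem_closedBall_zero_iff.1 hz).trans_lt (mem_ball_zero_iff.1 hx))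
  have := (convex_closedBall (0 : E) ‖x‖).norm_image_sub_le_of_norm_hasFDerivWithin_le
    (f := u) (f' := fderiv ℝ u) (C := max C 0 * ‖x‖) (x := 0) (y := x)
    (fun z hz => (hb z (hsub z hz)).2.hasFDerivAt.hasFDerivWithinAt)
    (fun z hz => ((hb z (hsub z hz)).1).trans (mul_le_mul (le_max_left _ _)
      (mem_closedBall_zero_iff.1 hz) (norm_nonneg z) (le_max_right _ _)))
    (by simp) (by simp)
  rw [h0, sub_zero, sub_zero, Real.norm_eq_abs] at this
  linarith

/-! ### The remaining properties of the solution -/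

/-- An odd function vanishes on both axes, so both partial derivatives vanish at the origin. -/
lemma fderiv_eq_zero_of_isMeasurableOdd {u : Plane → ℝ} (hu : IsMeasurableOdd u)
    (hd : DifferentiableAt ℝ u 0) : fderiv ℝ u 0 = 0 := by
  have he : ∀ i, fderiv ℝ u 0 (coordVec i) = 0 := fun i => by
    have h := hd.hasFDerivAt.hasLineDerivAt (coordVec i)
    have hz : (fun t : ℝ => u (0 + t • coordVec i)) = fun _ => 0 := by
      ext t
      refine eq_zero_of_coordProd_eq_zero hu ?_
      fin_cases i <;> simp [coordProd, coordVec]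
    rw [HasLineDerivAt, hz] at h
    exact HasDerivAt.unique h (hasDerivAt_const (0 : ℝ) (0 : ℝ))
  ext v
  have hv : v = v 0 • coordVec 0 + v 1 • coordVec 1 := by
    ext i; fin_cases i <;> simp [coordVec]
  rw [hv, map_add, map_smul, map_smul, he, he]
  simp

lemma laplacian_coordProd (x : Plane) : Laplacian.laplacian coordProd x = 0 := by
  rw [laplacian_eq_sum_fderiv contDiff_coordProd]
  have hp : ∀ (i : Fin 2) (y : Plane), HasFDerivAt (fun z : Plane => z i)
      (EuclideanSpace.proj i : Plane →L[ℝ] ℝ) y := fun i y =>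
    (EuclideanSpace.proj i : Plane →L[ℝ] ℝ).hasFDerivAt
  have h1 : ∀ y : Plane, HasFDerivAt coordProd _ y := fun y => (hp 0 y).mul (hp 1 y)
  have h2 : ∀ (i : Fin 2) (y : Plane), fderiv ℝ coordProd y (coordVec i) = y (1 - i) := fun i y => by
    rw [(h1 y).fderiv]
    fin_cases i <;> simp [coordVec]
  simp only [h2, Fin.sum_univ_two, sub_zero, sub_self]
  rw [(hp 1 x).fderiv, (hp 0 x).fderiv]
  simp [coordVec]

lemma isDistribPoissonSolution_of_fixed {u : Plane → ℝ} (hu : IsMeasurableOdd u)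
    (hfix : u = poissonStep u) :
    IsDistribPoissonSolution u (fun x => -nonlin (u x)) (ball 0 1) := by
  have hcont : Continuous u := by
    rw [hfix]; exact hu.contDiff_poissonStep.continuous
  refine ⟨hcont.locallyIntegrable.locallyIntegrableOn _,
    (continuous_nonlin.comp hcont).neg.locallyIntegrable.locallyIntegrableOn _,
    fun φ hφ hs hsub => ?_⟩
  have hφ2 : ContDiff ℝ 2 φ := contDiff_infty.1 hφ 2
  have hL := continuous_laplacian hφ2
  have hLs := hasCompactSupport_laplacian hφ2 hs
  set K := kelvinExt fun y => nonlin (u y) with hK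
  have hP : ∫ x, coordProd x * Laplacian.laplacian φ x = 0 := by
    rw [integral_mul_laplacian contDiff_coordProd hφ2 hs]
    simp [laplacian_coordProd]
  have hV := hu.isDecaying.integral_logPot_mul_laplacian hφ2 hs
  have hsplit : ∫ x, u x * Laplacian.laplacian φ x =
      (∫ x, coordProd x * Laplacian.laplacian φ x) -
        logMass⁻¹ * ∫ x, logPot K x * Laplacian.laplacian φ x := by
    rw [← integral_const_mul, ← integral_sub]
    · congr 1 with x
      conv_lhs => rw [hfix]
      rw [poissonStep]
      ring
    · exact ((contDiff_coordProd (n := 0)).continuous.mul hL).integrable_of_hasCompactSupport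
        hLs.mul_left
    · exact ((hu.isDecaying.contDiff_logPot.continuous.mul hL).integrable_of_hasCompactSupport
        hLs.mul_left).const_mul _
  rw [hsplit, hP, hV, inv_mul_cancel_left₀ logMass_pos.ne', zero_sub, ← integral_neg]
  congr 1 with x
  -- The test function is supported in the disc, where the extension is `nonlin (u x)`; the image
  -- density outside is not seen.
  by_cases hx : x ∈ tsupport φ
  · rw [kelvinExt_of_norm_lt (mem_ball_zero_iff.1 (hsub hx))]
    ring
  · rw [image_eq_zero_of_notMem_tsupport hx]
    ring

lemma memBesovInfty_two_iff {g : Plane → ℝ} : MemBesovInfty 2 g ↔ Continuous g ∧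
    (∃ M, ∀ x, |g x| ≤ M) ∧ ∃ C, ∀ x h, |thirdDiff g x h| ≤ C * ‖h‖ ^ 2 := by
  have h2 : ⌊(2 : ℝ)⌋₊ + 1 = 3 := by norm_num
  simp only [MemBesovInfty, h2, fwdDiff_iterate_three, Real.rpow_two]

lemma memBesovInftyOn_of_fixed {u : Plane → ℝ} (hu : IsMeasurableOdd u) (hfix : u = poissonStep u) :
    MemBesovInftyOn 2 u (ball 0 1) := by
  set K := kelvinExt fun y => nonlin (u y) with hK
  -- The boundary datum is unbounded on the plane, so it is cut off by a bump equal to `1` on the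
  -- closed unit disc; the potential is already globally bounded.
  let η : ContDiffBump (0 : Plane) := ⟨1, 2, by norm_num, by norm_num⟩
  set F : Plane → ℝ := fun x => η x * coordProd x with hF
  have hFc : ContDiff ℝ 2 F := η.contDiff.mul contDiff_coordProd
  have hFs : HasCompactSupport F := η.hasCompactSupport.mul_right
  obtain ⟨M₁, hM₁⟩ := hFc.continuous.bounded_above_of_compact_support hFs
  obtain ⟨M₂, hM₂⟩ := exists_abs_logPot_le hu.isDecaying hu.isKelvinOdd
  obtain ⟨C₁, hC₁⟩ := exists_abs_thirdDiff_le_of_contDiff hFc hFs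
  obtain ⟨C₂, hC₂⟩ := hu.isDecaying.exists_abs_thirdDiff_logPot_le
  have hc := inv_pos.2 logMass_pos
  refine ⟨fun x => F x - logMass⁻¹ * logPot K x, memBesovInfty_two_iff.2 ⟨?_, ?_, ?_⟩, ?_⟩
  · exact hFc.continuous.sub (continuous_const.mul hu.isDecaying.contDiff_logPot.continuous)
  · refine ⟨M₁ + logMass⁻¹ * M₂, fun x => (abs_sub _ _).trans (add_le_add (hM₁ x) ?_)⟩
    rw [abs_mul, abs_of_pos hc]
    exact mul_le_mul_of_nonneg_left (hM₂ x) hc.le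
  · refine ⟨C₁ + logMass⁻¹ * C₂, fun x h => ?_⟩
    have he : thirdDiff (fun x => F x - logMass⁻¹ * logPot K x) x h =
        thirdDiff F x h - logMass⁻¹ * thirdDiff (logPot K) x h := by
      simp only [thirdDiff]; ring
    rw [he, add_mul, mul_assoc]
    refine (abs_sub _ _).trans (add_le_add (hC₁ x h) ?_)
    rw [abs_mul, abs_of_pos hc]
    exact mul_le_mul_of_nonneg_left (hC₂ x h) hc.le
  · intro x hx
    have h1 : η x = 1 := η.one_of_mem_closedBall (ball_subset_closedBall hx)
    conv_lhs => rw [hfix]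
    simp only [hF, h1, one_mul, poissonStep, hK]

theorem mainTheorem11 :
    ∃ (f : ℝ → ℝ) (u : Plane → ℝ),
      -- the nonlinearity: continuous, odd, with values in `[-1, 0]` on `[0, ∞)`
      Continuous f ∧ (∀ t, f (-t) = -f t) ∧ (∀ t, 0 ≤ t → f t ∈ Icc (-1 : ℝ) 0) ∧
      -- the solution of the Dirichlet problem
      MemBesovInftyOn 2 u (ball 0 1) ∧
      ContinuousOn u (closedBall 0 1) ∧
      IsDistribPoissonSolution u (fun x => f (u x)) (ball 0 1) ∧
      (∀ x : Plane, ‖x‖ = 1 → u x = x 0 * x 1) ∧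
      -- odd in each variable, nonnegative in the first quadrant
      (∀ x ∈ closedBall (0 : Plane) 1,
        u !₂[-x 0, x 1] = -u x ∧ u !₂[x 0, -x 1] = -u x) ∧
      (∀ x ∈ closedBall (0 : Plane) 1, 0 ≤ x 0 → 0 ≤ x 1 → 0 ≤ u x) ∧
      -- no quadratic bound at the critical point `0`
      u 0 = 0 ∧ HasFDerivAt u (0 : Plane →L[ℝ] ℝ) 0 ∧
      ¬ BddAbove ((fun x : Plane => u x / ‖x‖ ^ 2) '' (ball 0 1 \ {0})) ∧
      -- regularity
      ContDiffOn ℝ 1 u (ball 0 1) ∧ ¬ ContDiffOn ℝ 2 u (ball 0 1) := by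
  obtain ⟨u, hu, hfix, hup⟩ := exists_poissonStep_fixed
  have hC1 : ContDiff ℝ 1 u := by rw [hfix]; exact hu.contDiff_poissonStep
  have hd : DifferentiableAt ℝ u 0 := (hC1.differentiable (by norm_num)) 0
  have h0 : u 0 = 0 := eq_zero_of_coordProd_eq_zero hu (by simp [coordProd])
  have hD0 := fderiv_eq_zero_of_isMeasurableOdd hu hd
  have hlim := tendsto_div_norm_sq hu hfix hup
  have hne : ∀ n : ℕ, diagPt ((1 / 2) ^ (n + 1)) ≠ 0 := fun n h => by
    have := norm_diagPt_sq ((1 / 2) ^ (n + 1))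
    rw [h, norm_zero] at this
    have h2 : (0 : ℝ) < 2 * ((1 / 2) ^ (n + 1)) ^ 2 := by positivity
    norm_num at this
  refine ⟨fun t => -nonlin t, u, continuous_nonlin.neg, fun t => congrArg Neg.neg (nonlin_neg t), fun t ht => ?_,
    memBesovInftyOn_of_fixed hu hfix, hC1.continuous.continuousOn,
    isDistribPoissonSolution_of_fixed hu hfix, fun x hx => ?_, fun x _ => ⟨?_, ?_⟩,
    fun x hx hx0 hx1 => ?_, h0, hD0 ▸ hd.hasFDerivAt, ?_, hC1.contDiffOn, fun h2 => ?_⟩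
  · have := nonlin_mem ht
    exact ⟨by linarith [this.2], by linarith [this.1]⟩
  · rw [hfix, poissonStep, logPot_eq_zero hu.isDecaying hu.isKelvinOdd hx, mul_zero, sub_zero,
      coordProd]
  · rw [← hu.reflect 0 x]
    congr 1
    ext j; fin_cases j <;> simp [coordReflect_apply]
  · rw [← hu.reflect 1 x]
    congr 1
    ext j; fin_cases j <;> simp [coordReflect_apply]
  · have h := hup x (mem_closedBall_zero_iff.1 hx)
    rcases (mul_nonneg hx0 hx1).eq_or_lt with hz | hz
    · exact (eq_zero_of_coordProd_eq_zero hu hz.symm).ge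
    · have := nonneg_of_mul_nonneg_right h hz
      rw [coordProd] at this
      linarith
  · rintro ⟨M, hM⟩
    have hin : ∀ᶠ n : ℕ in atTop, diagPt ((1 / 2) ^ (n + 1)) ∈ ball (0 : Plane) 1 :=
      tendsto_diagPt.eventually (ball_mem_nhds _ one_pos)
    obtain ⟨n, hn, hnM⟩ := (hin.and (hlim.eventually_gt_atTop M)).exists
    exact absurd (hM ⟨_, ⟨hn, hne n⟩, rfl⟩) (not_le.2 hnM)
  -- A `C²` solution would be bounded by `C ‖x‖²` near the origin, against the growth along the
  -- diagonal.
  · obtain ⟨C, hC⟩ := exists_eventually_abs_le_of_contDiffAt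
      (h2.contDiffAt (ball_mem_nhds _ one_pos)) h0 hD0
    obtain ⟨n, hn, hnC⟩ :=
      ((tendsto_diagPt.eventually hC).and (hlim.eventually_gt_atTop C)).exists
    rw [lt_div_iff₀ (pow_pos (norm_pos_iff.2 (hne n)) 2)] at hnC
    linarith [le_abs_self (u (diagPt ((1 / 2) ^ (n + 1))))]
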